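/- Let $\mathbb{D}=\{z\in\mathbb{C}:|z|<1\}$ and let $H^2$ be the Hardy space of the disk, i.e. the closed subspace of $L^2(\mathbb{T})$ (with normalized Lebesgue measure on the unit circle $\mathbb{T}$) of functions whose Fourier coefficients of negative index vanish, where $f\in H^2$ is identified with the analytic function $f(z)=\sum_{n\ge 0}\hat f(n)z^n$ on $\mathbb{D}$. For $\mathbf{a}\subseteq\mathbb{D}$ put $\mathcal{Z}_{\mathbf a}=\{f\in H^2: f(w)=0 \text{ for all } w\in\mathbf a\}$ and $\lim\mathbf a=\overline{\mathbf a}\setminus\mathbf a$ (closure in $\mathbb{C}$), and say that $\mathbf a$ satisfies the Blaschke condition if $\sum_{w\in\mathbf a}(1-|w|)<\infty$. Let $\mathrm{Gr}(H^2)$ be the Grassmann manifold of $H^2$, the set of all closed subspaces of $H^2$, identified with the set of all self-adjoint projections in the algebra of bounded operators on $H^2$, with the linear connection $\frac{DX}{dt}=E_{\gamma(t)}(\dot X(t))$ for a tangent field $X$ along a curve $\gamma$, where $E_P(X)=PX(1-P)+(1-P)XP$. A geodesic joining closed subspaces $\mathcal S$ and $\mathcal T$ is a smooth curve $\gamma:[0,1]\to\mathrm{Gr}(H^2)$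 with $\frac{D\dot\gamma}{dt}=0$, $\gamma(0)=P_{\mathcal S}$ and $\gamma(1)=P_{\mathcal T}$. **Theorem.** For every integer $m\ge 0$ there are disjoint infinite sets $\mathbf a,\mathbf b\subseteq\mathbb{D}$ such that (i) $\mathbf a$ and $\mathbf b$ satisfy the Blaschke condition; (ii) $\lim\mathbf a=\lim\mathbf b=\{1\}$; (iii) $\dim(\mathcal Z_{\mathbf a}^\perp\cap\mathcal Z_{\mathbf b})=0$ and $\dim(\mathcal Z_{\mathbf a}\cap\mathcal Z_{\mathbf b}^\perp)=m$. Moreover, for all disjoint infinite sets $\mathbf a,\mathbf b\subseteq\mathbb{D}$ satisfying (i), (ii) and (iii), there is a geodesic in $\mathrm{Gr}(H^2)$ joining $\mathcal Z_{\mathbf a}$ and $\mathcal Z_{\mathbf b}$ if and only if $m=0$. -/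

import Mathlib

open MeasureTheory AddCircle Set
open scoped Real ComplexConjugate InnerProductSpace Complex.UnitDisc ContDiff

noncomputable section

instance instFactTwoPiPos : Fact (0 < 2 * π) := ⟨Real.two_pi_pos⟩

/-- The space `L²(𝕋)`: the circle is `ℝ / 2πℤ`, via `t ↦ e^{it}`, with normalized Lebesgue
measure `dt / 2π`. -/
abbrev CircleL2 : Type := Lp ℂ 2 (haarAddCircle : Measure (AddCircle (2 * π)))

theorem fourierCoeff_add_L2 (f g : CircleL2) (n : ℤ) :
    fourierCoeff (f + g : CircleL2) n = fourierCoeff f n + fourierCoeff g n := by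
  simp only [← fourierBasis_repr, map_add, lp.coeFn_add, Pi.add_apply]

theorem fourierCoeff_smul_L2 (c : ℂ) (f : CircleL2) (n : ℤ) :
    fourierCoeff (c • f : CircleL2) n = c * fourierCoeff f n := by
  simp only [← fourierBasis_repr, map_smul, lp.coeFn_smul, Pi.smul_apply, smul_eq_mul]

theorem fourierCoeff_zero_L2 (n : ℤ) : fourierCoeff (0 : CircleL2) n = 0 := by
  simpa using fourierCoeff_smul_L2 0 0 n

theorem norm_fourierCoeff_le_L2 (f : CircleL2) (n : ℤ) : ‖fourierCoeff f n‖ ≤ ‖f‖ := by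
  rw [← fourierBasis_repr, ← (fourierBasis (T := 2 * π)).repr.norm_map f]
  exact lp.norm_apply_le_norm (by norm_num) _ n

theorem continuous_fourierCoeff_L2 (n : ℤ) :
    Continuous fun f : CircleL2 => fourierCoeff f n := by
  have h : LipschitzWith 1 fun f : CircleL2 => fourierCoeff f n := by
    refine LipschitzWith.of_dist_le_mul fun f g => ?_
    have h1 : fourierCoeff (f - g : CircleL2) n = fourierCoeff f n - fourierCoeff g n := by
      simp only [← fourierBasis_repr, map_sub, lp.coeFn_sub, Pi.sub_apply]
    rw [dist_eq_norm, dist_eq_norm, ← h1]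
    simpa using norm_fourierCoeff_le_L2 (f - g) n
  exact h.continuous

/-- The Hardy space `H²`, as the subspace of `L²(𝕋)` of the functions whose Fourier coefficients
of negative index vanish. -/
def hardySpace : Submodule ℂ CircleL2 where
  carrier := {f | ∀ n : ℤ, n < 0 → fourierCoeff f n = 0}
  add_mem' := fun {f g} hf hg n hn => by
    rw [fourierCoeff_add_L2, hf n hn, hg n hn, add_zero]
  zero_mem' := fun n _ => fourierCoeff_zero_L2 n
  smul_mem' := fun c f hf n hn => by
    rw [fourierCoeff_smul_L2, hf n hn, mul_zero]

theorem isClosed_hardySpace : IsClosed (hardySpace : Set CircleL2) := by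
  have h : (hardySpace : Set CircleL2) =
      ⋂ n : ℤ, ⋂ _ : n < 0, {f : CircleL2 | fourierCoeff f n = 0} := by
    ext f
    simp [hardySpace]
  rw [h]
  exact isClosed_iInter fun n => isClosed_iInter fun _ =>
    isClosed_eq (continuous_fourierCoeff_L2 n) continuous_const

instance instCompleteSpaceHardySpace : CompleteSpace hardySpace :=
  isClosed_hardySpace.completeSpace_coe

/-- The value `f(w)` at a point `w` of the unit disk of (the holomorphic extension to the disk of)
a function `f ∈ H²`: the sum of the power series with the Fourier coefficients of `f`. -/
def hardyEval (f : hardySpace) (w : 𝔻) : ℂ :=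
  ∑' n : ℕ, fourierCoeff (f : CircleL2) n * (w : ℂ) ^ n

theorem summable_hardyEval (f : hardySpace) (w : 𝔻) :
    Summable fun n : ℕ => fourierCoeff (f : CircleL2) n * (w : ℂ) ^ n := by
  refine Summable.of_norm_bounded
    ((summable_geometric_of_lt_one (norm_nonneg (w : ℂ)) w.norm_lt_one).mul_left
      ‖(f : CircleL2)‖) fun n => ?_
  rw [norm_mul, norm_pow]
  exact mul_le_mul_of_nonneg_right (norm_fourierCoeff_le_L2 _ _) (by positivity)

/-- The subspace `Z_a` of the functions in `H²` that vanish at every point of `a`. -/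
def zeroSubspace (a : Set 𝔻) : Submodule ℂ hardySpace where
  carrier := {f | ∀ w ∈ a, hardyEval f w = 0}
  add_mem' := fun {f g} hf hg w hw => by
    have h : hardyEval (f + g) w = hardyEval f w + hardyEval g w := by
      unfold hardyEval
      rw [← (summable_hardyEval f w).tsum_add (summable_hardyEval g w)]
      refine tsum_congr fun n => ?_
      rw [Submodule.coe_add, fourierCoeff_add_L2, add_mul]
    rw [h, hf w hw, hg w hw, add_zero]
  zero_mem' := fun w _ => by
    unfold hardyEval
    simp only [Submodule.coe_zero, fourierCoeff_zero_L2, zero_mul, tsum_zero]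
  smul_mem' := fun c f hf w hw => by
    have h : hardyEval (c • f) w = c * hardyEval f w := by
      unfold hardyEval
      rw [← tsum_mul_left]
      refine tsum_congr fun n => ?_
      rw [Submodule.coe_smul, fourierCoeff_smul_L2, mul_assoc]
    rw [h, hf w hw, mul_zero]

/-- The Blaschke condition `∑_{w ∈ a} (1 - |w|) < ∞` for a set `a` of points of the disk. -/
def IsBlaschkeSet (a : Set 𝔻) : Prop :=
  Summable fun w : a => 1 - ‖((w : 𝔻) : ℂ)‖

/-- The limit set `lim a = closure a \ a`, with the closure taken in the complex plane. -/
def limitSet (a : Set 𝔻) : Set ℂ :=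
  closure ((fun w : 𝔻 => (w : ℂ)) '' a) \ ((fun w : 𝔻 => (w : ℂ)) '' a)

section Grassmann

variable {H : Type*} [NormedAddCommGroup H] [InnerProductSpace ℂ H]

/-- The map `E_P(X) = P X (1 - P) + (1 - P) X P`, the projection of the (self-adjoint) operators
onto the tangent space at `P` of the Grassmann manifold. -/
def tangentProj (P X : H →L[ℂ] H) : H →L[ℂ] H :=
  P * X * (1 - P) + (1 - P) * X * P

/-- The covariant derivative `DX/dt = E_{γ(t)}(X'(t))` of a field `X` along the curve `γ`, both
defined on the interval `I`. -/
def covariantDeriv (γ X : ℝ → H →L[ℂ] H) (I : Set ℝ) (t : ℝ) : H →L[ℂ] H :=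
  tangentProj (γ t) (derivWithin X I t)

/-- Geodesics of the Grassmann manifold, whose points are the self-adjoint projections: smooth
curves of self-adjoint projections whose velocity is parallel, `Dγ'/dt = 0`. -/
structure IsGrassmannGeodesic [CompleteSpace H] (γ : ℝ → H →L[ℂ] H) (I : Set ℝ) : Prop where
  isStarProjection : ∀ t ∈ I, IsStarProjection (γ t)
  smooth : ContDiffOn ℝ ∞ γ I
  parallel : ∀ t ∈ I, covariantDeriv γ (derivWithin γ I) I t = 0

/-- There is a geodesic `γ : [0, 1] → Gr(H)` from `S` to `T`, that is, one that starts at the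
orthogonal projection onto `S` and ends at the orthogonal projection onto `T`. -/
def JoinedByGeodesic [CompleteSpace H] (S T : Submodule ℂ H) : Prop :=
  ∃ γ : ℝ → H →L[ℂ] H, IsGrassmannGeodesic γ (Icc 0 1) ∧
    LinearMap.range (γ 0 : H →ₗ[ℂ] H) = S ∧ LinearMap.range (γ 1 : H →ₗ[ℂ] H) = T

end Grassmann

end

/-! The geodesic criterion is pure Hilbert space geometry. Let `P`, `Q` be the projections onto `S`,
`T` and `ε = 2P - 1`. Along a geodesic the commutator `Y = [γ', γ]` is constant and codiagonal, so
`Q = exp Y P exp (-Y)` and `ε exp Y ε = exp (-Y)`; hence `exp Y` maps `S ⊓ Tᗮ` injectively into `Sᗮ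
⊓ T` (`JoinedByGeodesic.inf_orthogonal_eq_bot`). If both intersections vanish, `B = P + Q - 1` is
injective, its unitary sign `J` exchanges `P` and `Q`, and the unitary `V = Jε` has positive real
part. Its logarithm is codiagonal and generates the geodesic
(`joinedByGeodesic_of_inf_orthogonal_eq_bot`).

For the examples, `Z_a` is the orthogonal complement of the kernels at `a`. The points `1 - e⁻ⁿ` are
simple zeros of `sin (π log (1 - z)) ∈ H²`, so their kernels `x n` have a biorthogonal sequence.
Kernels `y n` at points close enough to them satisfy `y n = (1 + D) (x n)` with `‖D‖ < 1`. Let `b`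
consist of the moved points and `a` of the zeros without the first `m`. The smallness of `D` kills
`Z_aᗮ ⊓ Z_b`, and the pairings with the `m` omitted kernels are coordinates on `Z_a ⊓ Z_bᗮ`. -/

/-! ### Idempotents and codiagonal elements of a ring -/

section Algebra

variable {R : Type*} [Ring R]

theorem mul_mul_eq_zero_of_mul_add_mul_eq {p d : R} (hp : p * p = p) (hd : p * d + d * p = d) :
    p * d * p = 0 := by
  have h : p * (p * d + d * p) = p * d := by rw [hd]
  rw [mul_add, ← mul_assoc, hp, add_eq_left, ← mul_assoc] at h
  exact h

/-- Differentiating `p² = p` gives `hd`. Since then `p d p = 0`, the double commutator `d p - 2 p d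
p + p d` is `d` again. This recovers `γ'` from `Y = [γ', γ]`. -/
theorem commutator_commutator_eq {p d : R} (hp : p * p = p) (hd : p * d + d * p = d) :
    (d * p - p * d) * p - p * (d * p - p * d) = d := by
  have h := mul_mul_eq_zero_of_mul_add_mul_eq hp hd
  have e : (d * p - p * d) * p - p * (d * p - p * d) =
      d * (p * p) + (p * p) * d - (2 : ℤ) • (p * d * p) := by noncomm_ring
  rw [e, hp, h, smul_zero, sub_zero, add_comm, hd]

/-- Multiplying by `p` on either side isolates one off-diagonal corner. For `x = γ''` the hypothesis
is the geodesic equation. -/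
theorem commute_of_offDiagonal_eq_zero {p x : R} (hp : p * p = p)
    (h : p * x * (1 - p) + (1 - p) * x * p = 0) : p * x = x * p := by
  have h1 : p * (p * x * (1 - p) + (1 - p) * x * p) = 0 := by rw [h, mul_zero]
  have h2 : (p * x * (1 - p) + (1 - p) * x * p) * p = 0 := by rw [h, zero_mul]
  have e1 : p * (p * x * (1 - p) + (1 - p) * x * p) =
    p * p * x - p * p * x * p + p * x * p - p * p * x * p := by noncomm_ring
  have e2 : (p * x * (1 - p) + (1 - p) * x * p) * p =
    p * x * p - p * x * (p * p) + x * (p * p) - p * x * (p * p) := by noncomm_ring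
  rw [e1, hp] at h1
  rw [e2, hp] at h2
  have h3 : p * x - p * x * p = 0 := by simpa using h1
  have h4 : x * p - p * x * p = 0 := by simpa using h2
  rw [sub_eq_zero.1 h3, sub_eq_zero.1 h4]

end Algebra

/-! ### Geodesics are orbits of one-parameter groups; the obstruction -/

section Geodesic

open NormedSpace

variable {H : Type*} [NormedAddCommGroup H] [InnerProductSpace ℂ H] [CompleteSpace H]

theorem IsStarProjection.mem_range_iff {P : H →L[ℂ] H} (hP : IsStarProjection P) {x : H} :
    x ∈ LinearMap.range (P : H →ₗ[ℂ] H) ↔ P x = x := by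
  constructor
  · rintro ⟨y, rfl⟩
    exact congrArg (fun A : H →L[ℂ] H => A y) hP.isIdempotentElem.eq
  · exact fun h => ⟨x, h⟩

theorem IsStarProjection.mem_range_orthogonal_iff {P : H →L[ℂ] H} (hP : IsStarProjection P)
    {x : H} : x ∈ (LinearMap.range (P : H →ₗ[ℂ] H))ᗮ ↔ P x = 0 := by
  have hsa : ∀ u v : H, ⟪P u, v⟫_ℂ = ⟪u, P v⟫_ℂ := fun u v => by
    rw [← ContinuousLinearMap.adjoint_inner_right, ← ContinuousLinearMap.star_eq_adjoint,
      hP.isSelfAdjoint.star_eq]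
  rw [Submodule.mem_orthogonal]
  constructor
  · intro h
    have := h (P (P x)) ⟨P x, rfl⟩
    rw [hsa] at this
    exact inner_self_eq_zero.1 this
  · rintro h _ ⟨y, rfl⟩
    change ⟪P y, x⟫_ℂ = 0
    rw [hsa, h, inner_zero_right]

theorem exp_mul_exp_neg_self (Y : H →L[ℂ] H) : exp Y * exp (-Y) = 1 := by
  let _ : NormedAlgebra ℚ (H →L[ℂ] H) := NormedAlgebra.restrictScalars ℚ ℂ _
  rw [← exp_add_of_commute (Commute.refl Y).neg_right, add_neg_cancel, exp_zero]

theorem exp_neg_mul_exp_self (Y : H →L[ℂ] H) : exp (-Y) * exp Y = 1 := by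
  simpa using exp_mul_exp_neg_self (-Y)

/-- The end points of a geodesic are conjugate by the exponential of a codiagonal operator. -/
theorem IsGrassmannGeodesic.exists_exp_conj {γ : ℝ → H →L[ℂ] H}
    (hγ : IsGrassmannGeodesic γ (Icc 0 1)) :
    ∃ Y : H →L[ℂ] H, γ 0 * Y + Y * γ 0 = Y ∧ γ 1 * exp Y = exp Y * γ 0 := by
  have huniq : UniqueDiffOn ℝ (Icc (0 : ℝ) 1) := uniqueDiffOn_Icc zero_lt_one
  set d := derivWithin γ (Icc 0 1)
  set dd := derivWithin d (Icc 0 1)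
  have hγ1 : ∀ t ∈ Icc (0 : ℝ) 1, HasDerivWithinAt γ (d t) (Icc 0 1) t := fun t ht =>
    ((hγ.smooth.differentiableOn (by simp)) t ht).hasDerivWithinAt
  have hd1 : ∀ t ∈ Icc (0 : ℝ) 1, HasDerivWithinAt d (dd t) (Icc 0 1) t := fun t ht =>
    (((hγ.smooth.derivWithin huniq (m := ∞) (by simp)).differentiableOn (by simp)) t
      ht).hasDerivWithinAt
  have hidem : ∀ t ∈ Icc (0 : ℝ) 1, γ t * γ t = γ t := fun t ht =>
    (hγ.isStarProjection t ht).isIdempotentElem.eq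
  have hprod : ∀ t ∈ Icc (0 : ℝ) 1, γ t * d t + d t * γ t = d t := fun t ht => by
    have h1 := (hγ1 t ht).mul (hγ1 t ht)
    have h2 : HasDerivWithinAt γ (d t * γ t + γ t * d t) (Icc 0 1) t :=
      h1.congr (fun s hs => (hidem s hs).symm) (hidem t ht).symm
    rw [add_comm]
    exact (huniq t ht).eq_deriv _ h2 (hγ1 t ht)
  have hcomm : ∀ t ∈ Icc (0 : ℝ) 1, γ t * dd t = dd t * γ t := fun t ht =>
    commute_of_offDiagonal_eq_zero (hidem t ht) (hγ.parallel t ht)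
  -- The derivative of `[γ', γ]` is `[γ'', γ]`, which vanishes by `hcomm`.
  have hY1 : ∀ t ∈ Icc (0 : ℝ) 1,
      HasDerivWithinAt (fun t => d t * γ t - γ t * d t) 0 (Icc 0 1) t := fun t ht => by
    refine (((hd1 t ht).mul (hγ1 t ht)).sub ((hγ1 t ht).mul (hd1 t ht))).congr_deriv ?_
    rw [hcomm t ht]
    abel
  set Y := d 0 * γ 0 - γ 0 * d 0 with hY
  have hconst : ∀ t ∈ Icc (0 : ℝ) 1, d t * γ t - γ t * d t = Y :=
    constant_of_derivWithin_zero (fun t ht => (hY1 t ht).differentiableWithinAt)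
      fun t ht => (hY1 t (Ico_subset_Icc_self ht)).derivWithin (huniq t (Ico_subset_Icc_self ht))
  have hd2 : ∀ t ∈ Icc (0 : ℝ) 1, Y * γ t - γ t * Y = d t := fun t ht => by
    rw [← hconst t ht]
    exact commutator_commutator_eq (hidem t ht) (hprod t ht)
  have h0 : (0 : ℝ) ∈ Icc (0 : ℝ) 1 := by simp
  have h1 : (1 : ℝ) ∈ Icc (0 : ℝ) 1 := by simp
  refine ⟨Y, ?_, ?_⟩
  · have e : γ 0 * Y + Y * γ 0 = d 0 * (γ 0 * γ 0) - (γ 0 * γ 0) * d 0 := by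
      rw [hY]; noncomm_ring
    rw [e, hidem 0 h0]
  -- Since `γ' = [Y, γ]`, undoing the flow of `Y` leaves a constant curve.
  · have hW : ∀ t ∈ Icc (0 : ℝ) 1, HasDerivWithinAt
        (fun t : ℝ => exp (t • -Y) * γ t * exp (t • Y)) 0 (Icc 0 1) t := fun t ht => by
      have a1 := (hasDerivAt_exp_smul_const (-Y) t).hasDerivWithinAt (s := Icc 0 1)
      have a2 := (hasDerivAt_exp_smul_const' Y t).hasDerivWithinAt (s := Icc 0 1)
      refine ((a1.mul (hγ1 t ht)).mul a2).congr_deriv ?_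
      change _ + exp (t • -Y) * γ t * (Y * exp (t • Y)) = 0
      rw [← hd2 t ht]
      noncomm_ring
    have := constant_of_derivWithin_zero (fun t ht => (hW t ht).differentiableWithinAt)
      (fun t ht => (hW t (Ico_subset_Icc_self ht)).derivWithin
        (huniq t (Ico_subset_Icc_self ht))) 1 h1
    simp only [one_smul, zero_smul, exp_zero, one_mul, mul_one] at this
    rw [← this, ← mul_assoc, ← mul_assoc, exp_mul_exp_neg_self, one_mul]

/-- Subspaces that are joined by a geodesic: if `Sᗮ ⊓ T` is trivial, then so is `S ⊓ Tᗮ`. -/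
theorem JoinedByGeodesic.inf_orthogonal_eq_bot {S T : Submodule ℂ H} (h : JoinedByGeodesic S T)
    (hST : Sᗮ ⊓ T = ⊥) : S ⊓ Tᗮ = ⊥ := by
  obtain ⟨γ, hγ, rfl, rfl⟩ := h
  obtain ⟨Y, hY, hconj⟩ := hγ.exists_exp_conj
  have hP := hγ.isStarProjection 0 (by simp)
  have hQ := hγ.isStarProjection 1 (by simp)
  set P := γ 0
  set Q := γ 1
  rw [eq_bot_iff]
  rintro x ⟨hx1, hx2⟩
  rw [SetLike.mem_coe, hP.mem_range_iff] at hx1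
  rw [SetLike.mem_coe, hQ.mem_range_orthogonal_iff] at hx2
  have inv1 : exp Y * exp (-Y) = 1 := exp_mul_exp_neg_self Y
  have inv2 : exp (-Y) * exp Y = 1 := exp_neg_mul_exp_self Y
  have hε : (2 * P - 1) * (2 * P - 1) = 1 := by
    have : (2 * P - 1) * (2 * P - 1) = 4 * (P * P) - 4 * P + 1 := by noncomm_ring
    rw [this, hP.isIdempotentElem.eq, sub_self, zero_add]
  -- Codiagonal means anticommuting with the reflection `2P - 1`, so conjugation by it inverts `exp
  -- Y`.
  have hεY : (2 * P - 1) * Y * (2 * P - 1) = -Y := by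
    have : (2 * P - 1) * Y = -Y * (2 * P - 1) := by
      rw [← sub_eq_zero]
      have : (2 * P - 1) * Y - -Y * (2 * P - 1) = 2 * (P * Y + Y * P) - 2 * Y := by noncomm_ring
      rw [this, hY, sub_self]
    rw [this, mul_assoc, hε, mul_one]
  have hexp : (2 * P - 1) * exp Y * (2 * P - 1) = exp (-Y) := by
    let _ : NormedAlgebra ℚ (H →L[ℂ] H) := NormedAlgebra.restrictScalars ℚ ℂ _
    have := exp_units_conj (⟨2 * P - 1, 2 * P - 1, hε, hε⟩ : (H →L[ℂ] H)ˣ) Y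
    simpa [hεY] using this.symm
  have hexp2 : (2 * P - 1) * exp (-Y) = exp Y * (2 * P - 1) := by
    rw [← hexp, ← mul_assoc, ← mul_assoc, hε, one_mul]
  have happ : ∀ (A B : H →L[ℂ] H) (v : H), (A * B) v = A (B v) := fun _ _ _ => rfl
  have hεapp : ∀ v : H, (2 * P - 1) v = (2 : ℂ) • P v - v := fun v => by
    have : (2 * P - 1 : H →L[ℂ] H) = (2 : ℂ) • P - 1 := by rw [two_smul, two_mul]
    rw [this]; rfl
  have hv1 : P (exp (-Y) x) = 0 := by
    have e : P * exp (-Y) = exp (-Y) * Q := by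
      calc P * exp (-Y) = exp (-Y) * exp Y * P * exp (-Y) := by rw [inv2, one_mul]
        _ = exp (-Y) * (exp Y * P) * exp (-Y) := by simp only [mul_assoc]
        _ = exp (-Y) * Q := by rw [← hconj, mul_assoc, mul_assoc, inv1, mul_one]
    rw [← happ, e, happ, hx2, map_zero]
  -- The reflection fixes `x ∈ S` and negates `exp (-Y) x ∈ Sᗮ`. So `exp Y x` lies in `Sᗮ`, and it
  -- lies in `T` by `hconj`.
  have hv2 : exp Y x = -exp (-Y) x := by
    have := congrArg (fun A : H →L[ℂ] H => A x) hexp2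
    simp only [happ] at this
    rw [hεapp, hεapp, hv1, hx1, smul_zero, zero_sub, two_smul, add_sub_cancel_right] at this
    exact this.symm
  have hv3 : exp Y x ∈ (⊥ : Submodule ℂ H) := by
    rw [← hST]
    refine ⟨?_, ?_⟩
    · rw [SetLike.mem_coe, hP.mem_range_orthogonal_iff]
      rw [hv2, map_neg, hv1, neg_zero]
    · rw [SetLike.mem_coe, hQ.mem_range_iff, ← happ, hconj, happ, hx1]
  rw [Submodule.mem_bot] at hv3 ⊢
  have hx : (exp (-Y) * exp Y) x = x := by rw [inv2]; rfl
  rw [← hx, happ, hv3, map_zero]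

end Geodesic

/-! ### Construction of geodesics from a unitary logarithm -/

section Geodesic

open NormedSpace

variable {H : Type*} [NormedAddCommGroup H] [InnerProductSpace ℂ H] [CompleteSpace H]

theorem contDiff_exp_smul (Y : H →L[ℂ] H) : ContDiff ℝ ∞ fun t : ℝ => exp (t • Y) :=
  contDiff_iff_contDiffAt.2 fun t =>
    ((exp_analytic (𝕂 := ℝ) (t • Y)).contDiffAt).comp t
      (contDiff_id.smul contDiff_const).contDiffAt

theorem commute_exp_smul (Y : H →L[ℂ] H) (t : ℝ) : Commute Y (exp (t • Y)) :=
  ((Commute.refl Y).smul_right t).exp_right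

/-- The one-parameter group of a codiagonal skew-adjoint operator moves a projection along a
geodesic. -/
theorem isGrassmannGeodesic_exp_conj {P Y : H →L[ℂ] H} (hP : IsStarProjection P)
    (hPY : P * Y + Y * P = Y) (hY : star Y = -Y) (I : Set ℝ) (hI : UniqueDiffOn ℝ I) :
    IsGrassmannGeodesic (fun t : ℝ => exp (t • Y) * P * exp (-(t • Y))) I := by
  set γ : ℝ → H →L[ℂ] H := fun t => exp (t • Y) * P * exp (-(t • Y)) with hγ
  have hidem : ∀ t, γ t * γ t = γ t := fun t => by
    calc γ t * γ t = exp (t • Y) * P * (exp (-(t • Y)) * exp (t • Y)) * P * exp (-(t • Y)) := by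
          simp only [hγ, mul_assoc]
      _ = exp (t • Y) * (P * P) * exp (-(t • Y)) := by
          rw [exp_neg_mul_exp_self, mul_one]; simp only [mul_assoc]
      _ = γ t := by rw [hP.isIdempotentElem.eq]
  have hcomm : ∀ t, Y * exp (t • Y) = exp (t • Y) * Y := fun t => (commute_exp_smul Y t).eq
  have hcomm' : ∀ t : ℝ, Y * exp (-(t • Y)) = exp (-(t • Y)) * Y := fun t => by
    rw [← neg_smul]; exact (commute_exp_smul Y (-t)).eq
  have hYγ : ∀ t, γ t * Y + Y * γ t = Y := fun t => by
    have e1 : γ t * Y = exp (t • Y) * (P * Y) * exp (-(t • Y)) := by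
      simp only [hγ, mul_assoc, hcomm']
    have e2 : Y * γ t = exp (t • Y) * (Y * P) * exp (-(t • Y)) := by
      simp only [hγ, ← mul_assoc, hcomm]
    rw [e1, e2, ← add_mul, ← mul_add, hPY, mul_assoc, hcomm', ← mul_assoc, exp_mul_exp_neg_self,
      one_mul]
  have hγ1 : ∀ t, HasDerivAt γ (Y * γ t - γ t * Y) t := fun t => by
    have a1 := hasDerivAt_exp_smul_const' Y t
    have a2 := hasDerivAt_exp_smul_const (-Y) t
    have a3 := (a1.mul_const P).mul a2
    simp only [smul_neg] at a3
    refine a3.congr_deriv ?_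
    change Y * exp (t • Y) * P * exp (-(t • Y)) +
      exp (t • Y) * P * (exp (-(t • Y)) * -Y) = _
    simp only [hγ]
    noncomm_ring
  have hγ2 : ∀ t, HasDerivAt (fun t => Y * γ t - γ t * Y)
      (Y * (Y * γ t - γ t * Y) - (Y * γ t - γ t * Y) * Y) t := fun t =>
    ((hγ1 t).const_mul Y).sub ((hγ1 t).mul_const Y)
  refine ⟨fun t _ => ⟨hidem t, ?_⟩, ?_, fun t ht => ?_⟩
  · have hs : star (exp (t • Y)) = exp (-(t • Y)) := by
      rw [star_exp, star_smul, hY, star_trivial, smul_neg]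
    have hs' : star (exp (-(t • Y))) = exp (t • Y) := by rw [← hs, star_star]
    change star (γ t) = γ t
    rw [hγ]
    simp only [star_mul, hs, hs', hP.isSelfAdjoint.star_eq, mul_assoc]
  · refine ContDiff.contDiffOn ?_
    have := ((contDiff_exp_smul Y).mul contDiff_const (g := fun _ => P)).mul (contDiff_exp_smul (-Y))
    simpa only [smul_neg] using this
  · have h1 : EqOn (derivWithin γ I) (fun t => Y * γ t - γ t * Y) I := fun s hs =>
      (hγ1 s).hasDerivWithinAt.derivWithin (hI s hs)
    rw [covariantDeriv, derivWithin_congr h1 (h1 ht),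
      (hγ2 t).hasDerivWithinAt.derivWithin (hI t ht), tangentProj]
    have hYg : Y * γ t = Y - γ t * Y := by rw [eq_sub_iff_add_eq, add_comm, hYγ]
    -- Passing `Y` across `γ t` twice shows that `Y²` commutes with `γ t`. Then `γ'' = 4 γ Y² - 2
    -- Y²` does too, so its off-diagonal part vanishes.
    have hc : Y * Y * γ t = γ t * (Y * Y) := by
      rw [mul_assoc, hYg, mul_sub, ← mul_assoc, hYg, sub_mul, sub_sub_cancel, mul_assoc]
    have hx : Y * (Y * γ t - γ t * Y) - (Y * γ t - γ t * Y) * Y =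
        4 • (γ t * (Y * Y)) - 2 • (Y * Y) := by
      have e : Y * (Y * γ t - γ t * Y) - (Y * γ t - γ t * Y) * Y =
        Y * Y * γ t - 2 • (Y * γ t * Y) + γ t * (Y * Y) := by noncomm_ring
      rw [e, hYg, hc]
      noncomm_ring
    rw [hx]
    have hg := hidem t
    generalize γ t = p at *
    generalize Y * Y = z at *
    have hpz : p * z * p = p * z := by rw [mul_assoc, hc, ← mul_assoc, hg]
    have e : p * (4 • (p * z) - 2 • z) * (1 - p) + (1 - p) * (4 • (p * z) - 2 • z) * p =
      4 • (p * p * z) - 2 • (p * z) - 4 • (p * p * z * p) + 2 • (p * z * p)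
      + 4 • (p * z * p) - 2 • (z * p) - 4 • (p * p * z * p) + 2 • (p * z * p) := by
      noncomm_ring
    rw [e, hg, hpz, hc]
    abel

/-- The self-adjoint unitary factor of the polar decomposition of an injective self-adjoint
operator. -/
theorem exists_polar_of_isSelfAdjoint {B : H →L[ℂ] H} (hB : IsSelfAdjoint B)
    (hinj : ∀ x, B x = 0 → x = 0) :
    ∃ J A : H →L[ℂ] H, 0 ≤ A ∧ A * A = B * B ∧ J * A = B ∧ J * J = 1 ∧ IsSelfAdjoint J ∧
      (∀ X, Commute (B * B) X → Commute A X) ∧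
      ∀ X Y : H →L[ℂ] H, X * A = Y * A → X = Y := by
  set A := CFC.abs B with hA
  have hA0 : 0 ≤ A := CFC.abs_nonneg B
  have hAsa : IsSelfAdjoint A := IsSelfAdjoint.of_nonneg hA0
  have hAA : A * A = B * B := by rw [hA, CFC.abs_mul_abs, hB.star_eq]
  have hAB : A * B = B * A := (CFC.commute_abs_self B hB.isStarNormal).eq
  have hsymm : ∀ {C : H →L[ℂ] H}, IsSelfAdjoint C → ∀ u v : H, ⟪C u, v⟫_ℂ = ⟪u, C v⟫_ℂ :=
    fun hC u v => by
      rw [← ContinuousLinearMap.adjoint_inner_right, ← ContinuousLinearMap.star_eq_adjoint,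
        hC.star_eq]
  have hnorm : ∀ x, ‖B x‖ = ‖A x‖ := fun x => by
    have h : ⟪B x, B x⟫_ℂ = ⟪A x, A x⟫_ℂ := by
      rw [hsymm hB, hsymm hAsa]
      exact congrArg (fun C : H →L[ℂ] H => ⟪x, C x⟫_ℂ) hAA.symm
    rw [inner_self_eq_norm_sq_to_K, inner_self_eq_norm_sq_to_K] at h
    exact (pow_left_inj₀ (norm_nonneg _) (norm_nonneg _) two_ne_zero).1 (by exact_mod_cast h)
  have hAinj : ∀ x, A x = 0 → x = 0 := fun x hx => hinj x (by
    rw [← norm_eq_zero, hnorm, hx, norm_zero])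
  have hdense : DenseRange (A : H →ₗ[ℂ] H) := by
    have : (LinearMap.range (A : H →ₗ[ℂ] H)).topologicalClosure = ⊤ := by
      rw [Submodule.topologicalClosure_eq_top_iff, eq_bot_iff]
      intro x hx
      refine hAinj x (inner_self_eq_zero (𝕜 := ℂ).1 ?_)
      rw [← hsymm hAsa]
      exact (Submodule.mem_orthogonal _ _).1 hx (A (A x)) ⟨A x, rfl⟩
    exact (Submodule.dense_iff_topologicalClosure_eq_top).2 this
  -- The range of `A` is dense, so identities between operators may be checked after right
  -- multiplication by `A`.
  have hcancel : ∀ X Y : H →L[ℂ] H, X * A = Y * A → X = Y := fun X Y h => by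
    have : (X : H → H) = Y := hdense.equalizer X.continuous Y.continuous (by
      ext v
      exact congrArg (fun C : H →L[ℂ] H => C v) h)
    exact DFunLike.coe_injective this
  -- By `hnorm`, `A x ↦ B x` is well defined and isometric on a dense subspace.
  set J : H →L[ℂ] H := (B : H →ₗ[ℂ] H).extendOfNorm (A : H →ₗ[ℂ] H) with hJ
  have hJA : J * A = B := by
    ext x
    exact LinearMap.extendOfNorm_eq hdense ⟨1, fun x => by
      rw [one_mul]; exact (hnorm x).le⟩ x
  have hAJ : A * J = J * A := hcancel _ _ (by
    rw [mul_assoc, hJA, hAB])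
  have hJstar : A * star J = B := by
    have := congrArg star hJA
    rwa [star_mul, hAsa.star_eq, hB.star_eq] at this
  refine ⟨J, A, hA0, hAA, hJA, ?_, ?_, fun X hX => ?_, hcancel⟩
  · refine hcancel _ _ (hcancel _ _ ?_)
    rw [one_mul, mul_assoc J J A, hJA, mul_assoc, ← hAB, ← mul_assoc, hJA, hAA]
  · have h1 : A * (star J - J) = 0 := by rw [mul_sub, hJstar, hAJ, hJA, sub_self]
    have h2 : star J - J = 0 := by
      ext x
      exact hAinj _ (congrArg (fun C : H →L[ℂ] H => C x) h1)
    exact sub_eq_zero.1 h2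
  · exact Commute.cfcₙ_nnreal (by rwa [hB.star_eq]) _

/-- The bound keeps the spectrum off the negative axis, where `arg (conj z) = -arg z` could fail and
`arg` is discontinuous. -/
theorem cfc_arg_star {V : H →L[ℂ] H} (hV : V ∈ unitary (H →L[ℂ] H)) (h : ‖V - 1‖ < 2) :
    cfc (Complex.arg · : ℂ → ℂ) (star V) = -cfc (Complex.arg · : ℂ → ℂ) V := by
  have hslit := (Unitary.spectrum_subset_slitPlane_iff_norm_lt_two hV).2 h
  have hnormal : IsStarNormal V := ⟨by
    rw [Commute, SemiconjBy, Unitary.star_mul_self_of_mem hV, Unitary.mul_star_self_of_mem hV]⟩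
  have hcont : ContinuousOn (Complex.arg · : ℂ → ℂ) (star '' spectrum ℂ V) := by
    refine Complex.continuous_ofReal.comp_continuousOn ?_
    rintro _ ⟨z, hz, rfl⟩
    refine (Complex.continuousAt_arg ?_).continuousWithinAt
    have := hslit hz
    rw [Complex.mem_slitPlane_iff] at this ⊢
    simpa using this
  rw [← cfc_comp_star _ V hcont hnormal, ← cfc_neg]
  refine cfc_congr fun z hz => ?_
  have := Complex.arg_conj z
  rw [if_neg (Complex.mem_slitPlane_iff_arg.1 (hslit hz)).1] at this
  simp only [RCLike.star_def, this, Complex.ofReal_neg]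

/-- Closed subspaces in generic position are joined by a geodesic. -/
theorem joinedByGeodesic_of_inf_orthogonal_eq_bot {S T : Submodule ℂ H}
    [S.HasOrthogonalProjection] [T.HasOrthogonalProjection]
    (h1 : Sᗮ ⊓ T = ⊥) (h2 : S ⊓ Tᗮ = ⊥) : JoinedByGeodesic S T := by
  set P : H →L[ℂ] H := S.starProjection with hPdef
  set Q : H →L[ℂ] H := T.starProjection with hQdef
  have hP : IsStarProjection P := isStarProjection_starProjection
  have hQ : IsStarProjection Q := isStarProjection_starProjection
  have hPP := hP.isIdempotentElem.eq
  have hQQ := hQ.isIdempotentElem.eq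
  have hPr : LinearMap.range (P : H →ₗ[ℂ] H) = S := Submodule.range_starProjection S
  have hQr : LinearMap.range (Q : H →ₗ[ℂ] H) = T := Submodule.range_starProjection T
  have hB : IsSelfAdjoint (P + Q - 1) :=
    (hP.isSelfAdjoint.add hQ.isSelfAdjoint).sub (IsSelfAdjoint.one _)
  -- If `P x + Q x = x`, applying `P` and `Q` gives `P (Q x) = 0 = Q (P x)`, so both summands lie in
  -- trivial intersections.
  have hinj : ∀ x, (P + Q - 1) x = 0 → x = 0 := fun x hx => by
    have hx' : P x + Q x = x := sub_eq_zero.1 hx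
    have e1 : P (Q x) = 0 := by
      have := congrArg P hx'
      rw [map_add, show P (P x) = P x from congrArg (fun C : H →L[ℂ] H => C x) hPP] at this
      simpa using this
    have e2 : Q (P x) = 0 := by
      have := congrArg Q hx'
      rw [map_add, show Q (Q x) = Q x from congrArg (fun C : H →L[ℂ] H => C x) hQQ] at this
      simpa using this
    have m1 : P x ∈ S ⊓ Tᗮ := ⟨by rw [← hPr]; exact ⟨x, rfl⟩, by
      rw [← hQr]; exact hQ.mem_range_orthogonal_iff.2 e2⟩
    have m2 : Q x ∈ Sᗮ ⊓ T := ⟨by rw [← hPr]; exact hP.mem_range_orthogonal_iff.2 e1, by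
      rw [← hQr]; exact ⟨x, rfl⟩⟩
    rw [h2, Submodule.mem_bot] at m1
    rw [h1, Submodule.mem_bot] at m2
    rw [← hx', m1, m2, add_zero]
  obtain ⟨J, A, hA0, hAA, hJA, hJJ, hJ, hAcomm, hcancel⟩ := exists_polar_of_isSelfAdjoint hB hinj
  set B := P + Q - 1 with hBdef
  have hBP : B * P = Q * P := by rw [hBdef, sub_mul, add_mul, hPP]; simp
  have hPB : P * B = P * Q := by rw [hBdef, mul_sub, mul_add, hPP]; simp
  have hQB : Q * B = Q * P := by rw [hBdef, mul_sub, mul_add, hQQ]; simp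
  have hBQ : B * Q = P * Q := by rw [hBdef, sub_mul, add_mul, hQQ]; simp
  -- Both `B² P` and `P B²` equal `P Q P`.
  have hAP : A * P = P * A :=
    (hAcomm P (by rw [Commute, SemiconjBy, mul_assoc, hBP, ← mul_assoc, hBQ, ← mul_assoc P, hPB,
      mul_assoc P Q B, hQB, mul_assoc])).eq
  have hJP : J * P = Q * J := hcancel _ _ (by
    rw [mul_assoc, ← hAP, ← mul_assoc, hJA, hBP, mul_assoc, hJA, hQB])
  have hεε : (2 * P - 1) * (2 * P - 1) = 1 := by
    have : (2 * P - 1) * (2 * P - 1) = 4 * (P * P) - 4 * P + 1 := by noncomm_ring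
    rw [this, hPP, sub_self, zero_add]
  have hεP : (2 * P - 1) * P = P := by
    rw [sub_mul, mul_assoc, hPP, two_mul, one_mul, add_sub_cancel_right]
  have hPε : P * (2 * P - 1) = P := by
    rw [mul_sub, two_mul, mul_add, hPP, mul_one, add_sub_cancel_right]
  have hεA : (2 * P - 1) * A = A * (2 * P - 1) := by
    have e1 : (2 * P - 1) * A = 2 * (P * A) - A := by noncomm_ring
    have e2 : A * (2 * P - 1) = 2 * (A * P) - A := by noncomm_ring
    rw [e1, e2, hAP]
  have hε : IsSelfAdjoint (2 * P - 1) := by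
    rw [two_mul]
    exact (hP.isSelfAdjoint.add hP.isSelfAdjoint).sub (IsSelfAdjoint.one _)
  set ε := 2 * P - 1 with hεdef
  set V := J * ε with hVdef
  have hVs : star V = ε * J := by rw [hVdef, star_mul, hJ.star_eq, hε.star_eq]
  have hVu : V ∈ unitary (H →L[ℂ] H) := by
    rw [Unitary.mem_iff, hVs]
    constructor
    · rw [hVdef, mul_assoc, ← mul_assoc J J, hJJ, one_mul, hεε]
    · rw [hVdef, mul_assoc, ← mul_assoc ε ε, hεε, one_mul, hJJ]
  -- After multiplication by `A` this becomes `B ε + ε B = 2 B²`.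
  have hVV : V + star V = 2 * A := hcancel _ _ (by
    rw [hVs, hVdef, add_mul, mul_assoc, hεA, ← mul_assoc, hJA, mul_assoc, hJA, mul_assoc, hAA]
    have e : B * ε + ε * B = 2 * (B * P) + 2 * (P * B) - 2 * B := by rw [hεdef]; noncomm_ring
    have e' : B * B = B * P + B * Q - B := by
      conv_lhs => rw [hBdef]
      rw [← hBdef, mul_sub, mul_add, mul_one]
    rw [e, e', hBP, hPB, hBQ]
    noncomm_ring)
  -- As `V + star V = 2A ≥ 0`, `‖(V - 1) x‖² = 2‖x‖² - 2 re ⟪A x, x⟫ ≤ 2‖x‖²`.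
  have hVnorm : ‖V - 1‖ < 2 := by
    have hle : ‖V - 1‖ ≤ √2 := by
      refine ContinuousLinearMap.opNorm_le_bound _ (Real.sqrt_nonneg 2) fun x => ?_
      have hstar : star (V - 1) * (V - 1) = 2 - 2 * A := by
        rw [← hVV, star_sub, star_one, sub_mul, mul_sub, Unitary.star_mul_self_of_mem hVu,
          show (2 : H →L[ℂ] H) = 1 + 1 by norm_num]
        noncomm_ring
      have hx : ‖(V - 1) x‖ ^ 2 = 2 * ‖x‖ ^ 2 - 2 * RCLike.re ⟪A x, x⟫_ℂ := by
        have e1 := ContinuousLinearMap.apply_norm_sq_eq_inner_adjoint_left (V - 1) x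
        rw [← ContinuousLinearMap.star_eq_adjoint] at e1
        rw [e1, show (star (V - 1)).comp (V - 1) = star (V - 1) * (V - 1) from rfl, hstar, two_mul]
        have e2 : (2 - (A + A) : H →L[ℂ] H) x = (2 : ℝ) • x - (2 : ℝ) • A x := by
          rw [two_smul, two_smul, show (2 : H →L[ℂ] H) = 1 + 1 by norm_num]
          rfl
        rw [e2, inner_sub_left, inner_smul_left_eq_smul, inner_smul_left_eq_smul, map_sub,
          RCLike.smul_re, RCLike.smul_re, inner_self_eq_norm_sq]
      have hA1 : 0 ≤ RCLike.re ⟪A x, x⟫_ℂ :=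
        ((ContinuousLinearMap.nonneg_iff_isPositive A).1 hA0).re_inner_nonneg_left x
      refine abs_le_of_sq_le_sq' ?_ (by positivity) |>.2
      rw [hx, mul_pow, Real.sq_sqrt zero_le_two]
      linarith
    refine hle.trans_lt ?_
    rw [Real.sqrt_lt' zero_lt_two]
    norm_num
  set X := Unitary.argSelfAdjoint (⟨V, hVu⟩ : unitary (H →L[ℂ] H)) with hX
  have hexp : exp (Complex.I • (X : H →L[ℂ] H)) = V := by
    have := congrArg (fun u : unitary (H →L[ℂ] H) => (u : H →L[ℂ] H))
      (expUnitary_argSelfAdjoint (u := (⟨V, hVu⟩ : unitary (H →L[ℂ] H))) hVnorm)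
    simpa only [selfAdjoint.expUnitary_coe] using this
  -- Conjugation by `ε` is a star automorphism taking `V` to `star V`, hence negating its argument.
  have hεX : ε * X * ε = -X := by
    have hεu : ε ∈ unitary (H →L[ℂ] H) := by
      rw [Unitary.mem_iff, hε.star_eq]
      exact ⟨hεε, hεε⟩
    have hslit := (Unitary.spectrum_subset_slitPlane_iff_norm_lt_two hVu).2 hVnorm
    have hcont : ContinuousOn (Complex.arg · : ℂ → ℂ) (spectrum ℂ V) :=
      Complex.continuous_ofReal.comp_continuousOn
        (Complex.continuousOn_arg.mono hslit)
    have hnormal : ∀ W ∈ unitary (H →L[ℂ] H), IsStarNormal W := fun W hW => ⟨by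
      rw [Commute, SemiconjBy, Unitary.star_mul_self_of_mem hW, Unitary.mul_star_self_of_mem hW]⟩
    have hconj : ε * V * ε = star V := by
      rw [hVs, hVdef, mul_assoc, mul_assoc, hεε, mul_one]
    set φ := Unitary.conjStarAlgAut ℂ (H →L[ℂ] H) ⟨ε, hεu⟩ with hφ
    have hφa : ∀ W, φ W = ε * W * ε := fun W => by
      rw [hφ, Unitary.conjStarAlgAut_apply]
      change ε * W * star ε = _
      rw [hε.star_eq]
    have hφc : Continuous φ := by
      have : (φ : (H →L[ℂ] H) → (H →L[ℂ] H)) = fun W => ε * W * ε := funext hφa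
      rw [this]
      fun_prop
    have := StarAlgHomClass.map_cfc (S := ℂ) φ (Complex.arg · : ℂ → ℂ) V hcont hφc (hnormal V hVu)
      (by rw [hφa, hconj]; exact hnormal _ (Unitary.star_mem hVu))
    rw [hφa, hφa, hconj, cfc_arg_star hVu hVnorm] at this
    exact this
  set Y : H →L[ℂ] H := Complex.I • (X : H →L[ℂ] H) with hYdef
  have hYstar : star Y = -Y := by
    rw [hYdef, star_smul, X.2.star_eq]
    simp
  have hPY : P * Y + Y * P = Y := by
    have h1 : ε * X = -(X * ε) := by
      calc ε * X = ε * X * (ε * ε) := by rw [hεε, mul_one]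
        _ = (ε * X * ε) * ε := by simp only [mul_assoc]
        _ = -(X * ε) := by rw [hεX, neg_mul]
    have h2 : (2 : ℂ) • (P * X + X * P - X : H →L[ℂ] H) = 0 := by
      have : (2 : ℂ) • (P * X + X * P - X : H →L[ℂ] H) = ε * X + X * ε := by
        rw [two_smul, hεdef]; noncomm_ring
      rw [this, h1, neg_add_cancel]
    have h3 := sub_eq_zero.1 ((smul_eq_zero.1 h2).resolve_left two_ne_zero)
    rw [hYdef, mul_smul_comm, smul_mul_assoc, ← smul_add, h3]
  refine ⟨_, isGrassmannGeodesic_exp_conj hP hPY hYstar _ (uniqueDiffOn_Icc zero_lt_one), ?_, ?_⟩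
  · simpa using hPr
  · have hexp' : exp (-Y) = star V := by rw [← hYstar, ← star_exp, hexp]
    have : V * P * star V = Q := by
      rw [hVs, hVdef, mul_assoc J, hεP, mul_assoc, ← mul_assoc P, hPε, ← mul_assoc, hJP, mul_assoc, hJJ,
        mul_one]
    simp only [one_smul]
    rw [hexp, hexp', this, hQr]

end Geodesic

/-! ### Small perturbations of a sequence with a biorthogonal system -/

section Perturbation

open InnerProductSpace

variable {H : Type*} [NormedAddCommGroup H] [InnerProductSpace ℂ H]

theorem mem_orthogonal_span_image_iff {ι : Type*} (x : ι → H) (s : Set ι) (f : H) :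
    f ∈ (Submodule.span ℂ (x '' s))ᗮ ↔ ∀ i ∈ s, ⟪x i, f⟫_ℂ = 0 := by
  constructor
  · exact fun h i hi => (Submodule.mem_orthogonal _ _).1 h _ (Submodule.subset_span ⟨i, hi, rfl⟩)
  · intro h
    rw [Submodule.mem_orthogonal']
    intro u hu
    induction hu using Submodule.span_induction with
    | mem u hu =>
      obtain ⟨i, hi, rfl⟩ := hu
      rw [← inner_conj_symm, h i hi, map_zero]
    | zero => exact inner_zero_right _
    | add u v _ _ hu hv => rw [inner_add_right, hu, hv, add_zero]
    | smul c u _ hu => rw [inner_smul_right, hu, mul_zero]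

theorem norm_inner_self_eq (v : H) : ‖⟪v, v⟫_ℂ‖ = ‖v‖ * ‖v‖ := by
  rw [inner_self_eq_norm_sq_to_K, norm_pow, RCLike.norm_ofReal, abs_norm, sq]

/-- By Cauchy–Schwarz, `‖f‖² = |⟪f, D f⟫| ≤ ‖D‖ ‖f‖²`. -/
theorem eq_zero_of_inner_self_add_eq_zero {D : H →L[ℂ] H} (hD : ‖D‖ < 1) {f : H}
    (hf : ⟪f, f + D f⟫_ℂ = 0) : f = 0 := by
  rw [inner_add_right, add_eq_zero_iff_eq_neg] at hf
  have h1 : ‖⟪f, f⟫_ℂ‖ ≤ ‖D‖ * (‖f‖ * ‖f‖) := by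
    rw [hf, norm_neg]
    calc ‖⟪f, D f⟫_ℂ‖ ≤ ‖f‖ * ‖D f‖ := norm_inner_le_norm _ _
      _ ≤ ‖f‖ * (‖D‖ * ‖f‖) := by gcongr; exact D.le_opNorm f
      _ = _ := by ring
  rw [norm_inner_self_eq] at h1
  by_contra h
  have : 0 < ‖f‖ * ‖f‖ := mul_pos (norm_pos_iff.2 h) (norm_pos_iff.2 h)
  nlinarith

variable [CompleteSpace H]

/-- A sequence `y` that is close enough to a sequence `x` with the biorthogonal sequence `g` is the
image of `x` under an operator close to the identity. -/
theorem exists_perturbation {x y g : ℕ → H} (hg : ∀ i j, ⟪g i, x j⟫_ℂ = if i = j then 1 else 0)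
    (hs : ∀ n, ‖g n‖ * ‖y n - x n‖ ≤ (1 / 2) ^ (n + 2)) :
    ∃ D : H →L[ℂ] H, ‖D‖ < 1 ∧ ∀ n, x n + D (x n) = y n := by
  -- The operator is `D = ∑ ⟪g n, ·⟫ (y n - x n)`, with norm at most `1/4 · 2 = 1/2`;
  -- biorthogonality leaves a single term at `x n`.
  have hnorm : ∀ n, ‖rankOne ℂ (y n - x n) (g n)‖ ≤ (1 / 2) ^ 2 * (1 / 2 : ℝ) ^ n := fun n => by
    rw [norm_rankOne, mul_comm, ← pow_add, add_comm]
    exact hs n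
  have hgeo : HasSum (fun n : ℕ => (1 / 2 : ℝ) ^ 2 * (1 / 2) ^ n) ((1 / 2) ^ 2 * 2) :=
    hasSum_geometric_two.mul_left _
  have hsum : Summable fun n => rankOne ℂ (y n - x n) (g n) :=
    Summable.of_norm_bounded hgeo.summable hnorm
  refine ⟨∑' n, rankOne ℂ (y n - x n) (g n), ?_, fun n => ?_⟩
  · exact (tsum_of_norm_bounded hgeo hnorm).trans_lt (by norm_num)
  · have h1 : (∑' k, rankOne ℂ (y k - x k) (g k)) (x n) =
        ∑' k, rankOne ℂ (y k - x k) (g k) (x n) :=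
      (ContinuousLinearMap.apply ℂ H (x n)).map_tsum hsum
    rw [h1, tsum_eq_single n]
    · simp [rankOne_apply, hg]
    · intro k hk
      simp [rankOne_apply, hg, hk]

variable {x y : ℕ → H} {D : H →L[ℂ] H}

theorem adjoint_mem_orthogonal_span (hD : ∀ n, x n + D (x n) = y n) (s : Set ℕ) {z : H}
    (hz : z ∈ (Submodule.span ℂ (y '' s))ᗮ) :
    z + ContinuousLinearMap.adjoint D z ∈ (Submodule.span ℂ (x '' s))ᗮ := by
  rw [mem_orthogonal_span_image_iff] at hz ⊢
  intro i hi
  rw [inner_add_right, ContinuousLinearMap.adjoint_inner_right, ← inner_add_left, hD, hz i hi]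

theorem map_mem_orthogonal_orthogonal_span (hD : ∀ n, x n + D (x n) = y n) (s : Set ℕ) {h : H}
    (hh : h ∈ (Submodule.span ℂ (x '' s))ᗮᗮ) : h + D h ∈ (Submodule.span ℂ (y '' s))ᗮᗮ := by
  rw [Submodule.mem_orthogonal]
  intro z hz
  rw [inner_add_right, ← ContinuousLinearMap.adjoint_inner_left, ← inner_add_left]
  exact (Submodule.mem_orthogonal _ _).1 hh _ (adjoint_mem_orthogonal_span hD s hz)

/-- A double complement is a closed span. `1 + D` sends `f` into the closed span of the `y n`, to
which `f` is orthogonal, so `⟪f, f + D f⟫ = 0`. -/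
theorem orthogonal_orthogonal_inf_eq_bot (hD1 : ‖D‖ < 1) (hD : ∀ n, x n + D (x n) = y n)
    (s : Set ℕ) :
    (Submodule.span ℂ (x '' s))ᗮᗮ ⊓ (Submodule.span ℂ (range y))ᗮ = ⊥ := by
  rw [eq_bot_iff]
  rintro f ⟨hf1, hf2⟩
  refine eq_zero_of_inner_self_add_eq_zero hD1 ?_
  have := map_mem_orthogonal_orthogonal_span hD s hf1
  refine (Submodule.mem_orthogonal' _ _).1 this f ?_ |> fun h => by
    rw [← inner_conj_symm, h, map_zero]
  exact Submodule.orthogonal_le (Submodule.span_mono (image_subset_range _ _)) hf2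

theorem inf_orthogonal_orthogonal_eq_bot (hD1 : ‖D‖ < 1) (hD : ∀ n, x n + D (x n) = y n) :
    (Submodule.span ℂ (range x))ᗮ ⊓ (Submodule.span ℂ (range y))ᗮᗮ = ⊥ := by
  obtain ⟨u, hu⟩ : IsUnit (1 - -D) := isUnit_one_sub_of_norm_lt_one (by rwa [norm_neg])
  rw [sub_neg_eq_add] at hu
  have hT : ∀ v, (u : H →L[ℂ] H) v = v + D v := fun v => by rw [hu]; rfl
  set S : H →L[ℂ] H := ↑u⁻¹ with hS
  have hTS : ∀ v, S v + D (S v) = v := fun v => by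
    rw [← hT]; exact congrArg (fun C : H →L[ℂ] H => C v) u.mul_inv
  have hST : ∀ v, S (v + D v) = v := fun v => by
    rw [← hT]; exact congrArg (fun C : H →L[ℂ] H => C v) u.inv_mul
  rw [eq_bot_iff]
  rintro f ⟨hf1, hf2⟩
  -- The inverse `S = 1 + (S - 1)` carries `y` to `x`, so the mapping lemma applies with the roles
  -- exchanged.
  have hinv : ∀ n, y n + (S - 1) (y n) = x n := fun n => by
    rw [← hD n]
    change (x n + D (x n)) + (S (x n + D (x n)) - (x n + D (x n))) = _
    rw [hST, add_sub_cancel]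
  have hSf : S f ∈ (Submodule.span ℂ (range x))ᗮᗮ := by
    rw [← image_univ] at hf2 ⊢
    have := map_mem_orthogonal_orthogonal_span hinv univ hf2
    change f + (S f - f) ∈ _ at this
    rwa [add_sub_cancel] at this
  have : S f = 0 := by
    refine eq_zero_of_inner_self_add_eq_zero hD1 ?_
    rw [hTS]
    exact (Submodule.mem_orthogonal' _ _).1 hSf f hf1
  rw [Submodule.mem_bot, ← hTS f, this, map_zero, add_zero]

/-- Look for `f = h + D h` with `h` in the closed span `K` of the `x n` and the same projection to
`K` as `w = ∑ c i • g i`. This reads `h + P D P h = P w`, solvable because `‖P D P‖ < 1`. -/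
theorem exists_mem_orthogonal_orthogonal_inner_eq {g : ℕ → H}
    (hg : ∀ i j, ⟪g i, x j⟫_ℂ = if i = j then 1 else 0)
    (hD1 : ‖D‖ < 1) (hD : ∀ n, x n + D (x n) = y n) {m : ℕ} (c : Fin m → ℂ) :
    ∃ f ∈ (Submodule.span ℂ (range y))ᗮᗮ, ∀ j, ⟪x j, f⟫_ℂ = if h : j < m then c ⟨j, h⟩ else 0 := by
  set K := (Submodule.span ℂ (range x))ᗮᗮ with hK
  set P : H →L[ℂ] H := K.starProjection with hP
  have hPn : ‖P * D * P‖ < 1 := by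
    calc ‖P * D * P‖ ≤ ‖P * D‖ * ‖P‖ := norm_mul_le _ _
      _ ≤ ‖P‖ * ‖D‖ * ‖P‖ := by gcongr; exact norm_mul_le _ _
      _ ≤ 1 * ‖D‖ * 1 := by gcongr <;> exact K.starProjection_norm_le
      _ < 1 := by simpa
  obtain ⟨u, hu⟩ : IsUnit (1 - -(P * D * P)) := isUnit_one_sub_of_norm_lt_one (by rwa [norm_neg])
  rw [sub_neg_eq_add] at hu
  set w := ∑ i, c i • g i with hw
  set h : H := (↑u⁻¹ : H →L[ℂ] H) (P w) with hh
  have hh1 : h + P (D (P h)) = P w := by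
    have : (u : H →L[ℂ] H) h = P w := congrArg (fun C : H →L[ℂ] H => C (P w)) u.mul_inv
    rw [hu] at this
    exact this
  have hhK : h ∈ K := by
    rw [← add_sub_cancel_right h (P (D (P h))), hh1]
    exact K.sub_mem (K.starProjection_apply_mem _) (K.starProjection_apply_mem _)
  have hPh : P h = h := Submodule.starProjection_eq_self_iff.2 hhK
  refine ⟨h + D h, ?_, fun j => ?_⟩
  · rw [hK] at hhK
    rw [← image_univ] at hhK ⊢
    exact map_mem_orthogonal_orthogonal_span hD univ hhK
  · have hxK : P (x j) = x j := Submodule.starProjection_eq_self_iff.2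
      (Submodule.le_orthogonal_orthogonal _ (Submodule.subset_span ⟨j, rfl⟩))
    have hsymm : ∀ v, ⟪x j, P v⟫_ℂ = ⟪x j, v⟫_ℂ := fun v => by
      rw [← K.inner_starProjection_left_eq_right, ← hP, hxK]
    rw [← hsymm, map_add, hPh]
    nth_rw 2 [← hPh]
    rw [hh1, hsymm, hw, inner_sum]
    have : ∀ i : Fin m, ⟪x j, c i • g i⟫_ℂ = if (i : ℕ) = j then c i else 0 := fun i => by
      rw [inner_smul_right, ← inner_conj_symm, hg]
      split_ifs <;> simp
    simp only [this]
    split_ifs with hj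
    · rw [Finset.sum_eq_single ⟨j, hj⟩]
      · simp
      · intro i _ hi
        rw [if_neg fun h => hi (Fin.ext h)]
      · simp
    · refine Finset.sum_eq_zero fun i _ => if_neg ?_
      have := i.2
      omega

/-- Pairing with `x i` for `i < m` gives coordinates: a vector with all of them zero is orthogonal
to every `x n`, and the preceding lemma attains any values. -/
theorem rank_orthogonal_inf_orthogonal_orthogonal {g : ℕ → H}
    (hg : ∀ i j, ⟪g i, x j⟫_ℂ = if i = j then 1 else 0)
    (hD1 : ‖D‖ < 1) (hD : ∀ n, x n + D (x n) = y n) (m : ℕ) :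
    Module.rank ℂ ↥((Submodule.span ℂ (x '' Ici m))ᗮ ⊓ (Submodule.span ℂ (range y))ᗮᗮ) = m := by
  set M := (Submodule.span ℂ (x '' Ici m))ᗮ ⊓ (Submodule.span ℂ (range y))ᗮᗮ with hM
  let L : M →ₗ[ℂ] (Fin m → ℂ) :=
    LinearMap.pi fun i => ((innerSL ℂ (x i)) : H →ₗ[ℂ] ℂ) ∘ₗ M.subtype
  have hL : ∀ f i, L f i = ⟪x i, (f : H)⟫_ℂ := fun _ _ => rfl
  have hbij : Function.Bijective L := by
    constructor
    · rw [← LinearMap.ker_eq_bot, eq_bot_iff]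
      rintro ⟨f, hf1, hf2⟩ hf
      rw [SetLike.mem_coe, mem_orthogonal_span_image_iff] at hf1
      have hfx : f ∈ (Submodule.span ℂ (range x))ᗮ := by
        rw [← image_univ, mem_orthogonal_span_image_iff]
        intro i _
        by_cases hi : i < m
        · exact congrFun hf ⟨i, hi⟩
        · exact hf1 i (not_lt.1 hi)
      have : f ∈ (⊥ : Submodule ℂ H) := by
        rw [← inf_orthogonal_orthogonal_eq_bot hD1 hD]
        exact ⟨hfx, hf2⟩
      exact Subtype.ext this
    · intro c
      obtain ⟨f, hf1, hf2⟩ := exists_mem_orthogonal_orthogonal_inner_eq hg hD1 hD c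
      refine ⟨⟨f, ?_, hf1⟩, ?_⟩
      · rw [SetLike.mem_coe, mem_orthogonal_span_image_iff]
        intro i hi
        rw [hf2, dif_neg (not_lt.2 hi)]
      · ext i
        rw [hL, hf2, dif_pos i.2]
  simpa using (LinearEquiv.ofBijective L hbij).lift_rank_eq

end Perturbation

/-! ### Kernels, division by zeros, and a function in the Hardy space -/

noncomputable section Hardy

open Filter Topology

/-- Decay `1/n` is square summable; binomial coefficients with imaginary exponent have it, and
division by `z - w` preserves it. -/
theorem exists_hardySpace_fourierCoeff_eq {c : ℕ → ℂ} {C : ℝ} (hc : ∀ n, ‖c n‖ ≤ C / (n + 1)) :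
    ∃ f : hardySpace, ∀ n : ℕ, fourierCoeff (f : CircleL2) n = c n := by
  let u : ℤ → ℂ := fun k => if 0 ≤ k then c k.toNat else 0
  have hu : ∀ n : ℕ, u n = c n := fun n => by simp [u]
  have hsum : Summable fun k : ℤ => ‖u k‖ ^ (2 : ENNReal).toReal := by
    have hinj : Function.Injective (fun n : ℕ => (n : ℤ)) := Nat.cast_injective
    rw [← hinj.summable_iff]
    · have h2 : Summable fun n : ℕ => C ^ 2 * (1 / ((n : ℝ) + 1) ^ 2) := by
        have := (summable_nat_add_iff 1).2 (Real.summable_one_div_nat_pow.2 one_lt_two)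
        push_cast at this
        exact this.mul_left _
      refine Summable.of_nonneg_of_le (fun n => Real.rpow_nonneg (norm_nonneg _) _)
        (fun n => ?_) h2
      simp only [Function.comp_apply, hu]
      rw [ENNReal.toReal_ofNat, Real.rpow_two]
      calc ‖c n‖ ^ 2 ≤ (C / (n + 1)) ^ 2 := by gcongr; exact hc n
        _ = _ := by rw [div_pow, mul_one_div]
    · intro k hk
      have : ¬ 0 ≤ k := fun h => hk ⟨k.toNat, Int.toNat_of_nonneg h⟩
      simp [u, this]
  let v : lp (fun _ : ℤ => ℂ) 2 := ⟨u, memℓp_gen hsum⟩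
  have hv : ∀ k : ℤ, fourierCoeff ((fourierBasis (T := 2 * π)).repr.symm v : CircleL2) k = u k :=
    fun k => by rw [← fourierBasis_repr, LinearIsometryEquiv.apply_symm_apply]
  refine ⟨⟨(fourierBasis (T := 2 * π)).repr.symm v, fun k hk => ?_⟩, fun n => ?_⟩
  · rw [hv]
    exact if_neg (not_le.2 hk)
  · rw [hv, hu]

/-- Evaluation at a point of the disk, as a linear functional on `H²`. -/
def hardyEvalLinear (w : 𝔻) : hardySpace →ₗ[ℂ] ℂ where
  toFun f := hardyEval f w
  map_add' f g := by
    unfold hardyEval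
    rw [← (summable_hardyEval f w).tsum_add (summable_hardyEval g w)]
    refine tsum_congr fun n => ?_
    rw [Submodule.coe_add, fourierCoeff_add_L2, add_mul]
  map_smul' c f := by
    unfold hardyEval
    rw [RingHom.id_apply, smul_eq_mul, ← tsum_mul_left]
    refine tsum_congr fun n => ?_
    rw [Submodule.coe_smul, fourierCoeff_smul_L2, mul_assoc]

theorem norm_hardyEval_le (f : hardySpace) (w : 𝔻) :
    ‖hardyEval f w‖ ≤ (1 - ‖(w : ℂ)‖)⁻¹ * ‖f‖ := by
  refine tsum_of_norm_bounded (f := fun n : ℕ => fourierCoeff (f : CircleL2) n * (w : ℂ) ^ n)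
    ((hasSum_geometric_of_lt_one (norm_nonneg (w : ℂ)) w.norm_lt_one).mul_right ‖f‖) fun n => ?_
  rw [norm_mul, norm_pow, mul_comm]
  gcongr
  exact norm_fourierCoeff_le_L2 _ _

/-- The reproducing kernel of `H²`. -/
def hardyKernel (w : 𝔻) : hardySpace :=
  (InnerProductSpace.toDual ℂ hardySpace).symm
    ((hardyEvalLinear w).mkContinuous (1 - ‖(w : ℂ)‖)⁻¹ fun f => norm_hardyEval_le f w)

theorem inner_hardyKernel (w : 𝔻) (f : hardySpace) : ⟪hardyKernel w, f⟫_ℂ = hardyEval f w :=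
  InnerProductSpace.toDual_symm_apply

theorem zeroSubspace_eq (a : Set 𝔻) :
    zeroSubspace a = (Submodule.span ℂ (hardyKernel '' a))ᗮ := by
  ext f
  rw [mem_orthogonal_span_image_iff]
  simp only [inner_hardyKernel]
  rfl

/-- Pair the difference `k` with itself: `⟪k, k⟫ = k(z) - k(w)`, whose power series has coefficients
bounded by `‖k‖`. -/
theorem norm_hardyKernel_sub_le (z w : 𝔻) :
    ‖hardyKernel z - hardyKernel w‖ ≤ ∑' n : ℕ, ‖(z : ℂ) ^ n - (w : ℂ) ^ n‖ := by
  have hs : ∀ z : 𝔻, Summable fun n : ℕ => ‖(z : ℂ) ^ n‖ := fun z => by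
    simpa only [norm_pow] using summable_geometric_of_lt_one (norm_nonneg (z : ℂ)) z.norm_lt_one
  have hsum : Summable fun n : ℕ => ‖(z : ℂ) ^ n - (w : ℂ) ^ n‖ :=
    Summable.of_nonneg_of_le (fun _ => norm_nonneg _) (fun _ => norm_sub_le _ _) ((hs z).add (hs w))
  set k := hardyKernel z - hardyKernel w with hk
  have h1 : ‖k‖ * ‖k‖ ≤ (∑' n : ℕ, ‖(z : ℂ) ^ n - (w : ℂ) ^ n‖) * ‖k‖ := by
    have e : ⟪k, k⟫_ℂ = ∑' n : ℕ, fourierCoeff (k : CircleL2) n * ((z : ℂ) ^ n - (w : ℂ) ^ n) := by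
      conv_lhs => rw [hk, inner_sub_left, inner_hardyKernel, inner_hardyKernel, ← hk]
      unfold hardyEval
      rw [← (summable_hardyEval k z).tsum_sub (summable_hardyEval k w)]
      exact tsum_congr fun n => (mul_sub _ _ _).symm
    have e2 : ‖k‖ * ‖k‖ = ‖⟪k, k⟫_ℂ‖ := (norm_inner_self_eq k).symm
    rw [e2, e]
    refine tsum_of_norm_bounded (hsum.hasSum.mul_right ‖k‖) fun n => ?_
    rw [norm_mul, mul_comm]
    gcongr
    exact norm_fourierCoeff_le_L2 _ _
  rcases (norm_nonneg k).eq_or_lt with h | h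
  · rw [← h]
    exact tsum_nonneg fun _ => norm_nonneg _
  · exact le_of_mul_le_mul_right h1 h

theorem continuous_hardyKernel : Continuous hardyKernel := by
  rw [continuous_iff_continuousAt]
  intro w
  rw [ContinuousAt, tendsto_iff_norm_sub_tendsto_zero]
  obtain ⟨r, hr1, hr2⟩ := exists_between w.norm_lt_one
  have hr0 : 0 ≤ r := (norm_nonneg _).trans hr1.le
  have hcont : Continuous fun z : 𝔻 => (z : ℂ) := Complex.UnitDisc.continuous_coe
  have hlim : Tendsto (fun z : 𝔻 => ∑' n : ℕ, ‖(z : ℂ) ^ n - (w : ℂ) ^ n‖) (𝓝 w)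
      (𝓝 (∑' n : ℕ, ‖(w : ℂ) ^ n - (w : ℂ) ^ n‖)) := by
    refine tendsto_tsum_of_dominated_convergence (bound := fun n => 2 * r ^ n)
      ((summable_geometric_of_lt_one hr0 hr2).mul_left 2) (fun n => ?_) ?_
    · exact (((hcont.pow n).sub continuous_const).norm).tendsto w
    · filter_upwards [(hcont.norm.tendsto w).eventually (gt_mem_nhds hr1)] with z hz n
      rw [norm_norm, two_mul]
      refine (norm_sub_le _ _).trans ?_
      rw [norm_pow, norm_pow]
      gcongr
  simp only [sub_self, norm_zero, tsum_zero] at hlim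
  exact squeeze_zero (fun _ => norm_nonneg _) (fun z => norm_hardyKernel_sub_le z w) hlim

theorem continuous_hardyEval (f : hardySpace) : Continuous (hardyEval f) := by
  have : hardyEval f = fun w => ⟪hardyKernel w, f⟫_ℂ := funext fun w => (inner_hardyKernel w f).symm
  rw [this]
  exact continuous_hardyKernel.inner continuous_const

instance neBot_nhdsWithin_unitDisc (w : 𝔻) : (𝓝[≠] w).NeBot := by
  have h : 𝓝[≠] w = comap ((↑) : 𝔻 → ℂ) (𝓝[≠] (w : ℂ)) := by
    rw [nhdsWithin, nhdsWithin, comap_inf, ← Complex.UnitDisc.isEmbedding_coe.nhds_eq_comap,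
      comap_principal]
    congr 2
    ext z
    simp
  rw [h]
  refine NeBot.comap_of_range_mem inferInstance (mem_nhdsWithin_of_mem_nhds ?_)
  have : Metric.ball (0 : ℂ) 1 ∈ 𝓝 (w : ℂ) :=
    Metric.isOpen_ball.mem_nhds (by simpa using w.norm_lt_one)
  filter_upwards [this] with z hz
  exact ⟨Complex.UnitDisc.mk z (by simpa using hz), rfl⟩

/-- Division of a function of `H²` by a factor `z - w`, where `w` is one of its zeros. -/
theorem exists_hardySpace_divided {f : hardySpace} {C : ℝ}
    (hf : ∀ n : ℕ, ‖fourierCoeff (f : CircleL2) n‖ ≤ C / (n + 1)) {w : 𝔻} (hw : hardyEval f w = 0) :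
    ∃ q : hardySpace, ∀ z : 𝔻, hardyEval f z = (z - w) * hardyEval q z := by
  set c : ℕ → ℂ := fun n => fourierCoeff (f : CircleL2) n with hc
  have hC : 0 ≤ C := by simpa using (norm_nonneg _).trans (hf 0)
  have hgeo := hasSum_geometric_of_lt_one (norm_nonneg (w : ℂ)) w.norm_lt_one
  have hb : ∀ k j : ℕ, ‖c (k + j) * (w : ℂ) ^ j‖ ≤ C / (k + 1) * ‖(w : ℂ)‖ ^ j := fun k j => by
    rw [norm_mul, norm_pow]
    gcongr
    refine (hf (k + j)).trans ?_
    gcongr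
    linarith [Nat.cast_nonneg (α := ℝ) j]
  have hs : ∀ k, Summable fun j => c (k + j) * (w : ℂ) ^ j := fun k =>
    Summable.of_norm_bounded (hgeo.summable.mul_left _) (hb k)
  -- The quotient has coefficients `s (k + 1)`: comparing coefficients in `f = (z - w) q` gives `s k
  -- = c k + w s (k + 1)`, and `s 0 = f(w) = 0`.
  set s : ℕ → ℂ := fun k => ∑' j, c (k + j) * (w : ℂ) ^ j with hsdef
  have hs0 : s 0 = 0 := by
    simp only [hsdef, zero_add]
    exact hw
  have hstep : ∀ k, s k = c k + w * s (k + 1) := fun k => by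
    simp only [hsdef]
    rw [(hs k).tsum_eq_zero_add, ← tsum_mul_left]
    congr 1
    · simp
    · refine tsum_congr fun j => ?_
      rw [pow_succ, show k + (j + 1) = k + 1 + j by ring]
      ring
  have hbound : ∀ k, ‖s (k + 1)‖ ≤ C * (1 - ‖(w : ℂ)‖)⁻¹ / (k + 1) := fun k => by
    refine (tsum_of_norm_bounded (hgeo.mul_left _) (hb (k + 1))).trans ?_
    rw [div_mul_eq_mul_div]
    have : 0 ≤ (1 - ‖(w : ℂ)‖)⁻¹ := inv_nonneg.2 (sub_nonneg.2 w.norm_lt_one.le)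
    gcongr
    linarith
  obtain ⟨q, hq⟩ := exists_hardySpace_fourierCoeff_eq hbound
  refine ⟨q, fun z => ?_⟩
  have h1 := summable_hardyEval q z
  have h2 := summable_hardyEval f z
  have h3 : Summable fun n : ℕ => s n * (z : ℂ) ^ n := by
    rw [← summable_nat_add_iff 1]
    simp only [hq] at h1
    refine (h1.mul_right (z : ℂ)).congr fun n => ?_
    rw [pow_succ]; ring
  have e1 : ∑' n : ℕ, s n * (z : ℂ) ^ n = z * hardyEval q z := by
    rw [h3.tsum_eq_zero_add, hs0, zero_mul, zero_add, hardyEval, ← tsum_mul_left]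
    refine tsum_congr fun n => ?_
    rw [hq, pow_succ]; ring
  have e2 : ∑' n : ℕ, s n * (z : ℂ) ^ n = hardyEval f z + w * hardyEval q z := by
    rw [hardyEval, hardyEval, ← tsum_mul_left, ← h2.tsum_add (h1.mul_left _)]
    refine tsum_congr fun n => ?_
    rw [hq, hstep n]
    ring
  rw [sub_mul, ← e1, e2, add_sub_cancel_right]

/-- Since `|iy - n|² = n² + y²`, the quantity `n² |choose (iy) n|²` grows at each step by the factor
`1 + y²/n² ≤ exp (y²/n²)`, and `∑ 1/n²` converges. -/
theorem norm_choose_I_mul_le (y : ℝ) :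
    ∃ C : ℝ, ∀ n : ℕ, ‖Ring.choose (Complex.I * y) n‖ ≤ C / (n + 1) := by
  set a : ℂ := Complex.I * y with ha
  set p : ℕ → ℝ := fun n => ‖Ring.choose a n‖ ^ 2 with hp
  have hrec : ∀ n : ℕ, ((n : ℝ) + 1) ^ 2 * p (n + 1) = (n ^ 2 + y ^ 2) * p n := fun n => by
    have h := Ring.choose_smul_choose a (Nat.le_succ n)
    rw [Nat.succ_eq_add_one, Nat.choose_succ_self_right, Nat.add_sub_cancel_left,
      Ring.choose_one_right, nsmul_eq_mul] at h
    have h2 := congrArg (fun z : ℂ => ‖z‖ ^ 2) h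
    simp only [norm_mul, mul_pow] at h2
    have h3 : ‖a - n‖ ^ 2 = n ^ 2 + y ^ 2 := by
      rw [← Complex.normSq_eq_norm_sq, Complex.normSq_apply, ha]
      simp
      ring
    rw [h3, Complex.norm_natCast] at h2
    push_cast at h2
    simp only [hp]
    linarith
  have hsum : Summable fun k : ℕ => 1 / ((k : ℝ) + 1) ^ 2 := by
    have := (summable_nat_add_iff 1).2 (Real.summable_one_div_nat_pow.2 one_lt_two)
    exact_mod_cast this
  have hind : ∀ n : ℕ, ((n : ℝ) + 1) ^ 2 * p (n + 1) ≤
      p 1 * Real.exp (y ^ 2 * ∑ k ∈ Finset.range n, 1 / ((k : ℝ) + 1) ^ 2) := fun n => by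
    induction n with
    | zero => simp
    | succ n ih =>
      rw [hrec, Finset.sum_range_succ, mul_add, Real.exp_add, ← mul_assoc]
      push_cast
      calc (((n : ℝ) + 1) ^ 2 + y ^ 2) * p (n + 1)
          = (((n : ℝ) + 1) ^ 2 * p (n + 1)) * (y ^ 2 * (1 / ((n : ℝ) + 1) ^ 2) + 1) := by
            field_simp
            ring
        _ ≤ _ := by
            have : 0 ≤ p 1 := by positivity
            gcongr
            exact Real.add_one_le_exp _
  set M := p 1 * Real.exp (y ^ 2 * ∑' k : ℕ, 1 / ((k : ℝ) + 1) ^ 2) with hM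
  have hle : ∀ n : ℕ, ((n : ℝ) + 1) ^ 2 * p (n + 1) ≤ M := fun n => by
    refine (hind n).trans ?_
    have : 0 ≤ p 1 := by positivity
    rw [hM]
    gcongr
    exact hsum.sum_le_tsum _ fun k _ => by positivity
  -- The `1` serves `n = 0`; the factor `2` covers the passage from `n + 1` to `n + 2`.
  refine ⟨1 + 2 * √M, fun n => ?_⟩
  rcases n with _ | n
  · simp
  · have h1 : ((n : ℝ) + 1) * ‖Ring.choose a (n + 1)‖ ≤ √M := by
      refine Real.le_sqrt_of_sq_le ?_
      rw [mul_pow]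
      exact hle n
    rw [le_div_iff₀ (by positivity)]
    push_cast
    have h2 : ‖Ring.choose a (n + 1)‖ ≤ ((n : ℝ) + 1) * ‖Ring.choose a (n + 1)‖ :=
      le_mul_of_one_le_left (norm_nonneg _) (by linarith [Nat.cast_nonneg (α := ℝ) n])
    linarith

theorem hasSum_choose_mul_pow (a : ℂ) (z : 𝔻) :
    HasSum (fun n : ℕ => (Ring.choose a n * (-1) ^ n) * (z : ℂ) ^ n) ((1 - z : ℂ) ^ a) := by
  have hz : -(z : ℂ) ∈ Metric.eball (0 : ℂ) 1 := by
    rw [← ENNReal.ofReal_one, Metric.eball_ofReal]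
    simpa using z.norm_lt_one
  have := (Complex.one_add_cpow_hasFPowerSeriesOnBall_zero (a := a)).hasSum hz
  rw [zero_add, ← sub_eq_add_neg] at this
  convert! this using 2 with n
  rw [binomialSeries_apply, List.ofFn_const, List.prod_replicate, smul_eq_mul, neg_pow (z : ℂ), mul_assoc]

/-- The function `sin (π log (1 - z))` belongs to `H²`. -/
theorem exists_hardySpace_sin_log :
    ∃ (f : hardySpace) (C : ℝ), (∀ n : ℕ, ‖fourierCoeff (f : CircleL2) n‖ ≤ C / (n + 1)) ∧
      ∀ z : 𝔻, hardyEval f z = Complex.sin (π * Complex.log (1 - z)) := by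
  obtain ⟨C₁, h₁⟩ := norm_choose_I_mul_le (-π)
  obtain ⟨C₂, h₂⟩ := norm_choose_I_mul_le π
  -- With `L = log (1 - z)`, `sin (πL) = (e^{-iπL} - e^{iπL}) i/2` is a combination of the powers
  -- `(1 - z)^{∓iπ}`.
  set c : ℕ → ℂ := fun n => (Ring.choose (Complex.I * (-π : ℝ)) n * (-1) ^ n -
    Ring.choose (Complex.I * π) n * (-1) ^ n) * (Complex.I / 2) with hc
  have hb : ∀ n : ℕ, ‖c n‖ ≤ ((C₁ + C₂) / 2) / (n + 1) := fun n => by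
    have : ‖Complex.I / 2‖ = 1 / 2 := by simp
    rw [hc, norm_mul, this]
    refine (mul_le_mul_of_nonneg_right (norm_sub_le _ _) (by norm_num)).trans ?_
    simp only [norm_mul, norm_pow, norm_neg, norm_one, one_pow, mul_one]
    refine (mul_le_mul_of_nonneg_right (add_le_add (h₁ n) (h₂ n)) (by norm_num)).trans_eq ?_
    ring
  obtain ⟨f, hf⟩ := exists_hardySpace_fourierCoeff_eq hb
  refine ⟨f, (C₁ + C₂) / 2, fun n => by rw [hf]; exact hb n, fun z => ?_⟩
  have hz : (1 - z : ℂ) ≠ 0 := sub_ne_zero.2 fun h => z.coe_ne_one h.symm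
  have hsum := ((hasSum_choose_mul_pow (Complex.I * (-π : ℝ)) z).sub
    (hasSum_choose_mul_pow (Complex.I * π) z)).mul_right (Complex.I / 2)
  have e : HasSum (fun n : ℕ => fourierCoeff (f : CircleL2) n * (z : ℂ) ^ n) _ :=
    hsum.congr_fun fun n => by
      rw [hf, hc]
      ring
  rw [hardyEval, e.tsum_eq, Complex.sin, Complex.cpow_def_of_ne_zero hz, Complex.cpow_def_of_ne_zero hz]
  push_cast
  rw [show Complex.log (1 - z) * (Complex.I * -π) = -(π * Complex.log (1 - z)) * Complex.I by ring,
    show Complex.log (1 - z) * (Complex.I * π) = π * Complex.log (1 - z) * Complex.I by ring]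
  ring

end Hardy

/-! ### Interlacing point sets tending to `1` -/

noncomputable section Construction

open Filter Topology

theorem closure_range_eq_of_tendsto {X : Type*} [TopologicalSpace X] [T2Space X] {u : ℕ → X}
    {l : X} (hu : Tendsto u atTop (𝓝 l)) : closure (range u) = insert l (range u) := by
  refine Subset.antisymm (closure_minimal (subset_insert _ _) ?_) (insert_subset_iff.2 ⟨?_, ?_⟩)
  · exact hu.isCompact_insert_range.isClosed
  · exact mem_closure_of_tendsto hu (Eventually.of_forall fun n => mem_range_self n)
  · exact subset_closure

theorem limitSet_range_eq {A : ℕ → 𝔻} (hA : Tendsto (fun n => (A n : ℂ)) atTop (𝓝 1)) :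
    limitSet (range A) = {1} := by
  rw [limitSet, ← range_comp, Function.comp_def, closure_range_eq_of_tendsto hA]
  ext z
  constructor
  · rintro ⟨hz | hz, hz'⟩
    · exact hz
    · exact absurd hz hz'
  · rintro rfl
    exact ⟨mem_insert _ _, fun ⟨n, hn⟩ => (A n).coe_ne_one hn⟩

theorem isBlaschkeSet_range {A : ℕ → 𝔻} (hinj : Function.Injective A) {d : ℕ → ℝ}
    (hd : Summable d) (h : ∀ n, 1 - ‖(A n : ℂ)‖ ≤ d n) : IsBlaschkeSet (range A) := by
  rw [IsBlaschkeSet, ← (Equiv.ofInjective A hinj).summable_iff]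
  exact Summable.of_nonneg_of_le (fun n => sub_nonneg.2 (A n).norm_lt_one.le) h hd

/-- The points `1 - e⁻ⁿ`. -/
def sinLogZero (n : ℕ) : ℝ := 1 - Real.exp (-n)

theorem sinLogZero_nonneg (n : ℕ) : 0 ≤ sinLogZero n :=
  sub_nonneg.2 (Real.exp_le_one_iff.2 (neg_nonpos.2 n.cast_nonneg))

theorem sinLogZero_lt_one (n : ℕ) : sinLogZero n < 1 := sub_lt_self _ (Real.exp_pos _)

theorem strictMono_sinLogZero : StrictMono sinLogZero := fun i j h => by
  unfold sinLogZero
  have : (i : ℝ) < j := Nat.cast_lt.2 h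
  gcongr

theorem summable_exp_neg : Summable fun n : ℕ => Real.exp (-n) := Real.summable_exp_neg_nat

theorem tendsto_sinLogZero : Tendsto sinLogZero atTop (𝓝 1) := by
  simpa only [sub_zero] using!
    (tendsto_const_nhds (x := (1 : ℝ))).sub summable_exp_neg.tendsto_atTop_zero

/-- Here `log (1 - z) = -n`, so the sine vanishes and the cosine cannot: the zero is simple. -/
theorem hasDerivAt_sin_log (n : ℕ) :
    HasDerivAt (fun z : ℂ => Complex.sin (π * Complex.log (1 - z)))
      (Complex.cos (π * -(n : ℂ)) * (π * (-1 / (1 - (sinLogZero n : ℂ))))) (sinLogZero n) ∧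
    Complex.sin (π * Complex.log (1 - (sinLogZero n : ℂ))) = 0 ∧
    Complex.cos (π * -(n : ℂ)) * (π * (-1 / (1 - (sinLogZero n : ℂ)))) ≠ 0 := by
  have e : (1 : ℂ) - (sinLogZero n : ℂ) = (Real.exp (-n) : ℝ) := by
    unfold sinLogZero
    push_cast
    ring
  have elog : Complex.log (1 - (sinLogZero n : ℂ)) = -(n : ℂ) := by
    rw [e, ← Complex.ofReal_log (Real.exp_pos _).le, Real.log_exp]
    push_cast
    rfl
  have hne : (1 : ℂ) - (sinLogZero n : ℂ) ≠ 0 := by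
    rw [e]
    exact_mod_cast (Real.exp_pos _).ne'
  have hsin : Complex.sin (π * -(n : ℂ)) = 0 := by
    rw [mul_neg, Complex.sin_neg, mul_comm, Complex.sin_nat_mul_pi, neg_zero]
  refine ⟨?_, by rw [elog, hsin], ?_⟩
  · have h1 : HasDerivAt (fun z : ℂ => 1 - z) (-1) (sinLogZero n : ℂ) := by
      simpa using (hasDerivAt_id (sinLogZero n : ℂ)).const_sub 1
    have hslit : (1 : ℂ) - (sinLogZero n : ℂ) ∈ Complex.slitPlane := by
      rw [e]
      exact Complex.ofReal_mem_slitPlane.2 (Real.exp_pos _)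
    have := ((h1.clog hslit).const_mul (π : ℂ)).csin
    rwa [elog] at this
  · refine mul_ne_zero (fun h => ?_) (mul_ne_zero (by exact_mod_cast Real.pi_ne_zero)
      (div_ne_zero (by norm_num) hne))
    have := Complex.sin_sq_add_cos_sq (π * -(n : ℂ))
    rw [h, hsin] at this
    norm_num at this

/-- The points `1 - e⁻ⁿ`, as points of the disk. -/
def sinLogPoint (n : ℕ) : 𝔻 :=
  Complex.UnitDisc.mk (sinLogZero n) (by
    rw [Complex.norm_real, Real.norm_of_nonneg (sinLogZero_nonneg n)]
    exact sinLogZero_lt_one n)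

/-- The reproducing kernels at the zeros of `sin (π log (1 - z))` have a biorthogonal sequence. -/
theorem exists_biorthogonal_hardyKernel_sinLogPoint :
    ∃ g : ℕ → hardySpace, ∀ i j,
      ⟪g i, hardyKernel (sinLogPoint j)⟫_ℂ = if i = j then 1 else 0 := by
  obtain ⟨f, C, hC, hf⟩ := exists_hardySpace_sin_log
  have hzero : ∀ n, hardyEval f (sinLogPoint n) = 0 := fun n => by
    rw [hf]
    exact (hasDerivAt_sin_log n).2.1
  choose q hq using fun n => exists_hardySpace_divided hC (hzero n)
  have hq0 : ∀ i j, i ≠ j → hardyEval (q i) (sinLogPoint j) = 0 := fun i j hij => by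
    have h := hq i (sinLogPoint j)
    rw [hzero, zero_eq_mul] at h
    refine h.resolve_left (sub_ne_zero.2 fun h => hij ?_)
    exact strictMono_sinLogZero.injective (Complex.ofReal_injective h.symm)
  -- By continuity this value is the limit of the slopes of `sin (π log (1 - z))` within the disk,
  -- that is, the nonzero derivative.
  have hq1 : ∀ n, hardyEval (q n) (sinLogPoint n) ≠ 0 := fun n => by
    obtain ⟨h1, h2, h3⟩ := hasDerivAt_sin_log n
    rw [hasDerivAt_iff_tendsto_slope] at h1
    have hcoe : Tendsto ((↑) : 𝔻 → ℂ) (𝓝[≠] sinLogPoint n) (𝓝[≠] (sinLogZero n : ℂ)) := by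
      refine tendsto_nhdsWithin_iff.2 ⟨?_, ?_⟩
      · exact (Complex.UnitDisc.continuous_coe.tendsto (sinLogPoint n)).mono_left
          nhdsWithin_le_nhds
      · filter_upwards [self_mem_nhdsWithin] with z hz h
        exact hz (Complex.UnitDisc.coe_injective h)
    have hlim := h1.comp hcoe
    have hlim' : Tendsto (hardyEval (q n)) (𝓝[≠] sinLogPoint n)
        (𝓝 (hardyEval (q n) (sinLogPoint n))) :=
      ((continuous_hardyEval (q n)).tendsto _).mono_left nhdsWithin_le_nhds
    have heq : (slope (fun z : ℂ => Complex.sin (π * Complex.log (1 - z))) (sinLogZero n : ℂ)) ∘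
        ((↑) : 𝔻 → ℂ) =ᶠ[𝓝[≠] sinLogPoint n] hardyEval (q n) := by
      filter_upwards [self_mem_nhdsWithin] with z hz
      have hz' : (z : ℂ) - (sinLogZero n : ℂ) ≠ 0 :=
        sub_ne_zero.2 fun h => hz (Complex.UnitDisc.coe_injective h)
      rw [Function.comp_apply, slope_def_field, h2, sub_zero, ← hf z, hq n z]
      exact mul_div_cancel_left₀ _ hz'
    rw [tendsto_nhds_unique hlim' (hlim.congr' heq)]
    exact h3
  refine ⟨fun n => (hardyEval (q n) (sinLogPoint n))⁻¹ • q n, fun i j => ?_⟩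
  refine (inner_conj_symm (𝕜 := ℂ) (E := hardySpace) _ _).symm.trans ?_
  rw [inner_hardyKernel]
  change (starRingEnd ℂ) (hardyEvalLinear (sinLogPoint j) (_ • q i)) = _
  rw [map_smul, smul_eq_mul]
  change (starRingEnd ℂ) (_ * hardyEval (q i) (sinLogPoint j)) = _
  split_ifs with h
  · rw [h, inv_mul_cancel₀ (hq1 j), map_one]
  · rw [hq0 i j h, mul_zero, map_zero]

/-- Points interlacing the zeros of `sin (π log (1 - z))`, with reproducing kernels that are
arbitrarily close to those at the zeros. -/
theorem exists_interlacing_points {ε : ℕ → ℝ} (hε : ∀ n, 0 < ε n) :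
    ∃ (β : ℕ → ℝ) (B : ℕ → 𝔻), (∀ n, (B n : ℂ) = β n) ∧
      (∀ n, sinLogZero n < β n ∧ β n < sinLogZero (n + 1)) ∧
      ∀ n, ‖hardyKernel (B n) - hardyKernel (sinLogPoint n)‖ < ε n := by
  have key : ∀ n, ∃ (β : ℝ) (B : 𝔻), (B : ℂ) = β ∧ (sinLogZero n < β ∧ β < sinLogZero (n + 1)) ∧
      ‖hardyKernel B - hardyKernel (sinLogPoint n)‖ < ε n := fun n => by
    obtain ⟨U, hU, hUε⟩ : ∃ U ∈ 𝓝 (sinLogZero n : ℂ), ∀ B : 𝔻, (B : ℂ) ∈ U →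
        ‖hardyKernel B - hardyKernel (sinLogPoint n)‖ < ε n := by
      have h := (continuous_hardyKernel.tendsto (sinLogPoint n)).eventually
        (Metric.ball_mem_nhds _ (hε n))
      rw [Complex.UnitDisc.isEmbedding_coe.nhds_eq_comap] at h
      obtain ⟨U, hU, hUs⟩ := mem_comap.1 h
      refine ⟨U, hU, fun B hB => ?_⟩
      rw [← dist_eq_norm]
      exact hUs hB
    -- Moving only to the right, and short of the next zero, keeps the two sets disjoint.
    have hreal : ∀ᶠ t : ℝ in 𝓝[>] (sinLogZero n), (t : ℂ) ∈ U :=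
      ((Complex.continuous_ofReal.tendsto (sinLogZero n)).mono_left nhdsWithin_le_nhds) hU
    obtain ⟨β, hβU, hβ⟩ := (hreal.and
      (Ioo_mem_nhdsGT (strictMono_sinLogZero n.lt_succ_self))).exists
    have hβ1 : ‖(β : ℂ)‖ < 1 := by
      rw [Complex.norm_real, Real.norm_of_nonneg ((sinLogZero_nonneg n).trans hβ.1.le)]
      exact hβ.2.trans (sinLogZero_lt_one _)
    exact ⟨β, Complex.UnitDisc.mk β hβ1, rfl, hβ, hUε _ hβU⟩
  choose β B h1 h2 h3 using key
  exact ⟨β, B, h1, h2, h3⟩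

theorem exists_zeroSubspace_rank (m : ℕ) :
    ∃ a b : Set 𝔻, a.Infinite ∧ b.Infinite ∧ Disjoint a b ∧
      IsBlaschkeSet a ∧ IsBlaschkeSet b ∧ limitSet a = {1} ∧ limitSet b = {1} ∧
      Module.rank ℂ ↥((zeroSubspace a)ᗮ ⊓ zeroSubspace b) = 0 ∧
      Module.rank ℂ ↥(zeroSubspace a ⊓ (zeroSubspace b)ᗮ) = m := by
  obtain ⟨g, hg⟩ := exists_biorthogonal_hardyKernel_sinLogPoint
  -- The tolerance is the one required by `exists_perturbation`; adding `1` to `‖g n‖` keeps the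
  -- denominator positive.
  obtain ⟨β, B, hB, hβ, hker⟩ := exists_interlacing_points
    (ε := fun n => (1 / 2) ^ (n + 2) / (‖g n‖ + 1)) fun n => by positivity
  obtain ⟨D, hD1, hD⟩ := exists_perturbation (x := fun n => hardyKernel (sinLogPoint n))
    (y := fun n => hardyKernel (B n)) hg fun n => by
      calc ‖g n‖ * ‖hardyKernel (B n) - hardyKernel (sinLogPoint n)‖
          ≤ (‖g n‖ + 1) * ((1 / 2) ^ (n + 2) / (‖g n‖ + 1)) := by
            gcongr
            · linarith
            · exact (hker n).le
        _ = (1 / 2) ^ (n + 2) := mul_div_cancel₀ _ (by positivity)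
  have hA : ∀ n, (sinLogPoint n : ℂ) = (sinLogZero n : ℝ) := fun n => rfl
  have hAinj : Function.Injective sinLogPoint := fun i j h =>
    strictMono_sinLogZero.injective (Complex.ofReal_injective (congrArg ((↑) : 𝔻 → ℂ) h))
  have hβmono : StrictMono β := strictMono_nat_of_lt_succ fun n => (hβ n).2.trans (hβ (n + 1)).1
  have hBinj : Function.Injective B := fun i j h =>
    hβmono.injective (Complex.ofReal_injective (by rw [← hB, ← hB, h]))
  have hne : ∀ i j, sinLogPoint i ≠ B j := fun i j h => by
    have h' : sinLogZero i = β j := Complex.ofReal_injective (by rw [← hA, ← hB, h])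
    rcases le_or_gt i j with hij | hij
    · exact absurd h' ((strictMono_sinLogZero.monotone hij).trans_lt (hβ j).1).ne
    · exact absurd h' ((hβ j).2.trans_le (strictMono_sinLogZero.monotone hij)).ne'
  have hβlim : Tendsto β atTop (𝓝 1) :=
    tendsto_of_tendsto_of_tendsto_of_le_of_le tendsto_sinLogZero
      ((tendsto_add_atTop_iff_nat 1).2 tendsto_sinLogZero) (fun n => (hβ n).1.le)
      fun n => (hβ n).2.le
  have hshift : Function.Injective fun n => sinLogPoint (n + m) :=
    hAinj.comp (add_left_injective m)
  have himage : sinLogPoint '' Ici m = range fun n => sinLogPoint (n + m) := by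
    ext z
    constructor
    · rintro ⟨n, hn, rfl⟩
      exact ⟨n - m, by simp only [Nat.sub_add_cancel (show m ≤ n from hn)]⟩
    · rintro ⟨n, rfl⟩
      exact ⟨n + m, Nat.le_add_left m n, rfl⟩
  -- Omitting the first `m` zeros from `a`, but none of the moved points from `b`, creates exactly
  -- the `m` dimensions.
  refine ⟨sinLogPoint '' Ici m, range B, ?_, infinite_range_of_injective hBinj, ?_, ?_, ?_, ?_, ?_,
    ?_, ?_⟩
  · rw [himage]
    exact infinite_range_of_injective hshift
  · rw [Set.disjoint_left]
    rintro _ ⟨i, _, rfl⟩ ⟨j, hj⟩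
    exact hne i j hj.symm
  · rw [himage]
    refine isBlaschkeSet_range hshift ((summable_nat_add_iff m).2 summable_exp_neg) fun n => ?_
    rw [hA, Complex.norm_real, Real.norm_of_nonneg (sinLogZero_nonneg _), sinLogZero, sub_sub_cancel]
  · refine isBlaschkeSet_range hBinj summable_exp_neg fun n => ?_
    rw [hB, Complex.norm_real, Real.norm_of_nonneg ((sinLogZero_nonneg n).trans (hβ n).1.le)]
    have := (hβ n).1
    rw [sinLogZero] at this
    linarith
  · rw [himage]
    refine limitSet_range_eq ?_
    have := ((tendsto_add_atTop_iff_nat m).2 tendsto_sinLogZero)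
    exact_mod_cast (Complex.continuous_ofReal.tendsto 1).comp this
  · refine limitSet_range_eq ?_
    simp only [hB]
    exact_mod_cast (Complex.continuous_ofReal.tendsto 1).comp hβlim
  · rw [zeroSubspace_eq, zeroSubspace_eq, image_image, ← range_comp]
    exact (Submodule.rank_eq_zero).2 (orthogonal_orthogonal_inf_eq_bot hD1 hD (Ici m))
  · rw [zeroSubspace_eq, zeroSubspace_eq, image_image, ← range_comp]
    exact rank_orthogonal_inf_orthogonal_orthogonal hg hD1 hD m

end Construction

theorem theorem5p4 (m : ℕ) :
    (∃ a b : Set 𝔻, a.Infinite ∧ b.Infinite ∧ Disjoint a b ∧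
      IsBlaschkeSet a ∧ IsBlaschkeSet b ∧ limitSet a = {1} ∧ limitSet b = {1} ∧
      Module.rank ℂ ↥((zeroSubspace a)ᗮ ⊓ zeroSubspace b) = 0 ∧
      Module.rank ℂ ↥(zeroSubspace a ⊓ (zeroSubspace b)ᗮ) = m) ∧
    (∀ a b : Set 𝔻, a.Infinite → b.Infinite → Disjoint a b →
      IsBlaschkeSet a → IsBlaschkeSet b → limitSet a = {1} → limitSet b = {1} →
      Module.rank ℂ ↥((zeroSubspace a)ᗮ ⊓ zeroSubspace b) = 0 →
      Module.rank ℂ ↥(zeroSubspace a ⊓ (zeroSubspace b)ᗮ) = m →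
      (JoinedByGeodesic (zeroSubspace a) (zeroSubspace b) ↔ m = 0)) := by
  refine ⟨exists_zeroSubspace_rank m, fun a b _ _ _ _ _ _ _ h0 hm => ⟨fun h => ?_, ?_⟩⟩
  · have := h.inf_orthogonal_eq_bot (Submodule.rank_eq_zero.1 h0)
    rw [this, rank_bot] at hm
    exact_mod_cast hm.symm
  · rintro rfl
    have hm0 := Submodule.rank_eq_zero.1 (hm.trans Nat.cast_zero)
    have h00 := Submodule.rank_eq_zero.1 h0
    rw [zeroSubspace_eq a, zeroSubspace_eq b] at hm0 h00 ⊢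
    -- Orthogonal complements are closed, hence complete, which provides the orthogonal projections.
    have := fun s : Set 𝔻 =>
      (Submodule.isClosed_orthogonal (Submodule.span ℂ (hardyKernel '' s))).completeSpace_coe
    exact joinedByGeodesic_of_inf_orthogonal_eq_bot h00 hm0
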